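/- A mixture $F$ of two Gaussians in $\mathbb{R}^d$ is given by mixing probabilities $p_1,p_2\ge 0$, $p_1+p_2=1$, means $\mu^{(1)},\mu^{(2)}\in\mathbb{R}^d$ and positive semidefinite covariance matrices $\Sigma^{(1)},\Sigma^{(2)}$; write $\|\cdot\|_\infty$ for the largest absolute value of an entry and $\mathrm{Var}(F)=p_1p_2\|\mu^{(1)}-\mu^{(2)}\|_\infty^2+p_1\|\Sigma^{(1)}\|_\infty+p_2\|\Sigma^{(2)}\|_\infty$. A mixture $\widehat F$ is $\varepsilon$-close to $F$ if for some permutation $\pi$ of $\{1,2\}$ and both $i$, $\max\bigl(\|\mu^{(i)}-\widehat\mu^{(\pi(i))}\|_\infty^2,\|\Sigma^{(i)}-\widehat\Sigma^{(\pi(i))}\|_\infty\bigr)\le\varepsilon^2\,\mathrm{Var}(F)$. Fix $p_0\in(0,\tfrac12]$. A randomized algorithm $(\varepsilon,\delta)$-learns mixtures of two Gaussians in $\mathbb{R}^d$ from $f(\varepsilon,\delta)\in\mathbb{N}$ samples if for all $\varepsilon\in(0,1)$, $\delta\in(0,\tfrac12]$ and every mixture $F$ with $p_1,p_2\ge p_0$,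 given $\varepsilon$, $\delta$ and $f(\varepsilon,\delta)$ i.i.d. samples from $F$, it outputs with probability at least $1-\delta$ a mixture that is $\varepsilon$-close to $F$. Algorithms are randomized programs on exact real numbers (unit-cost rational constants, arithmetic, $\exp$, $\log$, comparisons, uniform random draws from $[0,1]$, and elementary list operations); such an algorithm runs in polynomial time if on every input, whatever its random draws, its number of steps is at most a fixed polynomial in the number of samples, $1/\varepsilon$ and $\log(1/\delta)$. **Theorem ((4 to 1)-reduction).** For every $p_0\in(0,\tfrac12]$ there are constants $c>0$ and $C\ge 0$ such that for every $f$: if there is a polynomial-time algorithm that $(\varepsilon,\delta)$-learns mixtures of two Gaussians in $\mathbb{R}$ from $f(\varepsilon,\delta)$ samples, then there is a polynomial-time algorithm that $(\varepsilon,\delta)$-learns mixtures of two Gaussians in $\mathbb{R}^4$ from $$f\!\left(c\,\varepsilon,\ \frac{c\,\delta}{\log\bigl(1/(\varepsilon\delta)\bigr)}\right)+\bigl\lceil C\log(1/\delta)\bigr\rceil$$ samples. -/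

import Mathlib

open MeasureTheory ProbabilityTheory

namespace GaussMix

/-! ### Mixtures of two Gaussians -/

/-- A mixture of two `d`-dimensional Gaussians: mixing probabilities, means and covariance
matrices of the two components (indexed by `Fin 2`). -/
structure Mixture (d : ℕ) where
  weight : Fin 2 → ℝ
  weight_nonneg : ∀ i, 0 ≤ weight i
  weight_sum : weight 0 + weight 1 = 1
  mean : Fin 2 → Fin d → ℝ
  cov : Fin 2 → Matrix (Fin d) (Fin d) ℝ
  cov_posSemidef : ∀ i, (cov i).PosSemidef

/-- The largest absolute value of an entry of a matrix. -/
noncomputable def entryNorm {d : ℕ} (A : Matrix (Fin d) (Fin d) ℝ) : ℝ :=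
  ‖fun ij : Fin d × Fin d => A ij.1 ij.2‖

namespace Mixture

/-- The distribution of one sample from the mixture. -/
noncomputable def law {d : ℕ} (F : Mixture d) : Measure (EuclideanSpace ℝ (Fin d)) :=
  ENNReal.ofReal (F.weight 0) • multivariateGaussian (WithLp.toLp 2 (F.mean 0)) (F.cov 0) +
    ENNReal.ofReal (F.weight 1) • multivariateGaussian (WithLp.toLp 2 (F.mean 1)) (F.cov 1)

/-- The "variance" of the mixture,
`p₁ p₂ ‖μ₁ - μ₂‖∞² + p₁ ‖Σ₁‖∞ + p₂ ‖Σ₂‖∞`; the norm on `Fin d → ℝ` is the sup norm. -/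
noncomputable def variance {d : ℕ} (F : Mixture d) : ℝ :=
  F.weight 0 * F.weight 1 * ‖F.mean 0 - F.mean 1‖ ^ 2 +
    F.weight 0 * entryNorm (F.cov 0) + F.weight 1 * entryNorm (F.cov 1)

/-- `G` is `ε`-close to `F` in parameter distance, up to a permutation of the components. -/
def IsClose {d : ℕ} (ε : ℝ) (G F : Mixture d) : Prop :=
  ∃ π : Equiv.Perm (Fin 2), ∀ i : Fin 2,
    max (‖F.mean i - G.mean (π i)‖ ^ 2) (entryNorm (F.cov i - G.cov (π i)))
      ≤ ε ^ 2 * F.variance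

end Mixture

/-! ### Randomized algorithms over the reals

A randomized real-number machine, presented as a finite first-order programming language over
reals, pairs, sums and lists. Every elementary operation on exact reals (rational constants,
`+`, `-`, `*`, `/`, `exp`, `log`, comparison, drawing a uniform random number) and every
elementary operation on data has unit cost. There is no rounding operation. -/

/-- Data types of the language. -/
inductive Ty : Type
  | unit : Ty
  | real : Ty
  | sum : Ty → Ty → Ty
  | prod : Ty → Ty → Ty
  | list : Ty → Ty

/-- Values of a data type. -/
def Ty.Val : Ty → Type
  | .unit => Unit
  | .real => ℝ
  | .sum a b => a.Val ⊕ b.Val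
  | .prod a b => a.Val × b.Val
  | .list a => List a.Val

/-- Binary and unary operations on exact real numbers. -/
inductive BinOp : Type
  | add | sub | mul | div

inductive UnOp : Type
  | exp | log

noncomputable def BinOp.apply : BinOp → ℝ → ℝ → ℝ
  | .add, x, y => x + y
  | .sub, x, y => x - y
  | .mul, x, y => x * y
  | .div, x, y => x / y

noncomputable def UnOp.apply : UnOp → ℝ → ℝ
  | .exp, x => Real.exp x
  | .log, x => Real.log x

/-- Programs with input type `a` and output type `b`. -/
inductive Prog : Ty → Ty → Type
  | id (a : Ty) : Prog a a
  | comp {a b c : Ty} (p : Prog a b) (q : Prog b c) : Prog a c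
  | drop (a : Ty) : Prog a .unit
  | pair {a b c : Ty} (p : Prog a b) (q : Prog a c) : Prog a (.prod b c)
  | fst (a b : Ty) : Prog (.prod a b) a
  | snd (a b : Ty) : Prog (.prod a b) b
  | inl (a b : Ty) : Prog a (.sum a b)
  | inr (a b : Ty) : Prog b (.sum a b)
  | cases {a b c d : Ty} (p : Prog (.prod a c) d) (q : Prog (.prod b c) d) :
      Prog (.prod (.sum a b) c) d
  | nil (a b : Ty) : Prog a (.list b)
  | cons (a : Ty) : Prog (.prod a (.list a)) (.list a)
  | uncons (a : Ty) : Prog (.list a) (.sum .unit (.prod a (.list a)))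
  | const (a : Ty) (q : ℚ) : Prog a .real
  | binOp (o : BinOp) : Prog (.prod .real .real) .real
  | unOp (o : UnOp) : Prog .real .real
  | less : Prog (.prod .real .real) (.sum .unit .unit)
  | rand (a : Ty) : Prog a .real
  | loop {a b : Ty} (p : Prog a (.sum a b)) : Prog a b

/-- The source of randomness: one number in `[0,1]` for every address of a point in the tree of
sub-computations of a run, so that every executed random draw reads a number of its own. -/
abbrev Tape : Type := List ℕ → unitInterval

/-- The part of the source of randomness that belongs to the `k`-th sub-computation. -/
def Tape.sub (ω : Tape) (k : ℕ) : Tape := fun l => ω (k :: l)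

/-- The random numbers are independent and uniform on `[0,1]`. -/
noncomputable def tapeLaw : Measure Tape :=
  Measure.infinitePi fun _ : List ℕ => (volume : Measure unitInterval)

/-- `p.Runs ω x y t`: with the random numbers `ω`, the program `p` halts on the input `x` with
the output `y` after exactly `t` steps. The program `loop p` repeats `p` as long as `p`
answers in the left summand. -/
def Prog.Runs : {a b : Ty} → Prog a b → Tape → a.Val → b.Val → ℕ → Prop
  | _, _, .id _, _, x, y, t => y = x ∧ t = 1
  | _, _, .comp p q, ω, x, y, t => ∃ z s s',
      p.Runs (ω.sub 0) x z s ∧ q.Runs (ω.sub 1) z y s' ∧ t = s + s' + 1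
  | _, _, .drop _, _, _, y, t => y = () ∧ t = 1
  | _, _, .pair p q, ω, x, y, t => ∃ s s',
      p.Runs (ω.sub 0) x y.1 s ∧ q.Runs (ω.sub 1) x y.2 s' ∧ t = s + s' + 1
  | _, _, .fst _ _, _, x, y, t => y = x.1 ∧ t = 1
  | _, _, .snd _ _, _, x, y, t => y = x.2 ∧ t = 1
  | _, _, .inl _ _, _, x, y, t => y = Sum.inl x ∧ t = 1
  | _, _, .inr _ _, _, x, y, t => y = Sum.inr x ∧ t = 1
  | _, _, .cases p q, ω, x, y, t => ∃ s, t = s + 1 ∧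
      ((∃ u, x.1 = Sum.inl u ∧ p.Runs (ω.sub 0) (u, x.2) y s) ∨
        (∃ v, x.1 = Sum.inr v ∧ q.Runs (ω.sub 1) (v, x.2) y s))
  | _, _, .nil _ _, _, _, y, t => y = [] ∧ t = 1
  | _, _, .cons _, _, x, y, t => y = List.cons x.1 x.2 ∧ t = 1
  | _, _, .uncons _, _, x, y, t => t = 1 ∧
      ((x = [] ∧ y = Sum.inl ()) ∨ (∃ u l, x = List.cons u l ∧ y = Sum.inr (u, l)))
  | _, _, .const _ q, _, _, y, t => y = (q : ℝ) ∧ t = 1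
  | _, _, .binOp o, _, x, y, t => y = o.apply x.1 x.2 ∧ t = 1
  | _, _, .unOp o, _, x, y, t => y = o.apply x ∧ t = 1
  | _, _, .less, _, x, y, t => t = 1 ∧
      ((@LT.lt ℝ _ x.1 x.2 ∧ y = Sum.inl ()) ∨ (¬ @LT.lt ℝ _ x.1 x.2 ∧ y = Sum.inr ()))
  | _, _, .rand _, ω, _, y, t => y = ((ω [] : unitInterval) : ℝ) ∧ t = 1
  | a, _, .loop p, ω, x, y, t => ∃ (n : ℕ) (z : ℕ → a.Val) (s : ℕ → ℕ),
      z 0 = x ∧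
      (∀ k < n, p.Runs (ω.sub k) (z k) (Sum.inl (z (k + 1))) (s k)) ∧
      p.Runs (ω.sub n) (z n) (Sum.inr y) (s n) ∧
      t = ∑ k ∈ Finset.range (n + 1), (s k + 1)

/-! ### Learning algorithms -/

/-- Vectors are lists of coordinates. -/
abbrev vecTy : Ty := .list .real

/-- The input of a learner: `ε`, `δ` and the list of samples. -/
abbrev inTy : Ty := .prod (.prod .real .real) (.list vecTy)

/-- One component of a mixture: its weight, mean and the rows of its covariance matrix. -/
abbrev compTy : Ty := .prod .real (.prod vecTy (.list vecTy))

/-- The output of a learner: the two components of a mixture. -/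
abbrev outTy : Ty := .prod compTy compTy

def encodeVec {d : ℕ} (v : Fin d → ℝ) : vecTy.Val := (List.ofFn v : List ℝ)

def encodeInput {d n : ℕ} (ε δ : ℝ) (x : Fin n → EuclideanSpace ℝ (Fin d)) : inTy.Val :=
  ((ε, δ), (List.ofFn fun j => encodeVec fun i => x j i : List vecTy.Val))

def encodeComponent {d : ℕ} (F : Mixture d) (i : Fin 2) : compTy.Val :=
  (F.weight i, encodeVec (F.mean i),
    (List.ofFn fun j => encodeVec (F.cov i j) : List vecTy.Val))

def encodeMixture {d : ℕ} (F : Mixture d) : outTy.Val :=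
  (encodeComponent F 0, encodeComponent F 1)

/-- The program `A`, as an algorithm on samples from `ℝ^d`, runs in polynomial time: on all
inputs and for all outcomes of its random draws it halts after a number of steps that is
polynomial in the number of samples, `1/ε` and `log (1/δ)`. -/
def PolyTime (d : ℕ) (A : Prog inTy outTy) : Prop :=
  ∃ k : ℕ, ∀ ε ∈ Set.Ioo (0 : ℝ) 1, ∀ δ ∈ Set.Ioc (0 : ℝ) (1 / 2),
    ∀ (n : ℕ) (x : Fin n → EuclideanSpace ℝ (Fin d)) (ω : Tape),
      ∃ y t, A.Runs ω (encodeInput ε δ x) y t ∧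
        (t : ℝ) ≤ k * (n + 1 / ε + Real.log (1 / δ) + 1) ^ k

/-- The program `A` `(ε,δ)`-learns mixtures of two Gaussians in `ℝ^d` with mixing probabilities
at least `p₀` from `f ε δ` samples: given `f ε δ` independent samples from any such mixture `F`,
with probability at least `1 - δ` (over the samples and the random draws of `A`) it outputs a
mixture that is `ε`-close to `F`. -/
def Learns (d : ℕ) (p₀ : ℝ) (A : Prog inTy outTy) (f : ℝ → ℝ → ℕ) : Prop :=
  ∀ ε ∈ Set.Ioo (0 : ℝ) 1, ∀ δ ∈ Set.Ioc (0 : ℝ) (1 / 2),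
    ∀ F : Mixture d, (∀ i, p₀ ≤ F.weight i) →
      ((Measure.pi fun _ : Fin (f ε δ) => F.law).prod tapeLaw)
        {z | ¬ ∃ (G : Mixture d) (t : ℕ),
          A.Runs z.2 (encodeInput ε δ z.1) (encodeMixture G) t ∧ G.IsClose ε F}
        ≤ ENNReal.ofReal δ

end GaussMix

/-!
A Gaussian mixture in `ℝ⁴` is determined by its one-dimensional projections to finitely many fixed
directions, stably and even if the labelling of the two components is lost separately in each
projection. So it suffices to run the one-dimensional learner on the projections of the same samples
to constantly many directions; a union bound controls the failure probability, and no additional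
samples are needed, i.e. `C = 0`.

*Directions.* The 25 directions are `(1, k, k⁴, k⁶)` for `k < 25`. Along the curve `(1, t, t⁴, t⁶)`,
a linear form is a polynomial in `t` of degree at most 6 and a quadratic form one of degree at most
12. As the exponents `0, 1, 4, 6` and their pairwise sums are distinct, the polynomial determines
the form, so Lagrange interpolation recovers a vector or a symmetric matrix from the values at any
13 directions (`exists_rat_eq_sum_linForm`, `exists_rat_eq_sum_quadForm`), and does so stably
(`exists_stability_bound`).

*Labelling.* For each of the constantly many ways to label the components in all projections, the
parameters are interpolated and compared with the data, and the labelling with the least misfit is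
chosen. The true labelling has a small misfit, hence so has the chosen one. There are only two
relabellings, so by the pigeonhole principle the two labellings differ by one and the same
relabelling in at least 13 of the 25 directions. By stability, the interpolated parameters are then
close to the true ones (`exists_reconstruction_bound`).

*Positive semidefiniteness.* The interpolated covariance matrices are made positive semidefinite by
adding a multiple of the identity. It has to exceed the error, which is a small multiple of `ε²
Var(F)`, but not `ε² Var(F)` itself. This is possible since the projections determine the order of
magnitude of `Var(F)` (`exists_scaleEst_bound`); the upper bound is where the lower bound on the
mixing probabilities is used.

*Programs.* Post-processing is a function of the outputs of the learner that is computed in constant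
time (`ConstTime`, `exists_constTime_argmin`, `exists_constTime_reconstruct`); projecting the
samples is a loop. The calls of the learner read different parts of the source of randomness, each
distributed like the whole (`measurePreserving_sub`), and the projected samples are independent
samples from the projected mixture (`map_projVec_law`). This gives the union bound
`callAll_measure_le`; it requires neither independence of the calls nor measurability of the events.
-/

namespace GaussMix

/-! ### Functions computed in constant time -/

/-- Some program computes `f` on all inputs and for all outcomes of its random draws, with a
uniform bound on the number of steps. -/
def ConstTime {a b : Ty} (f : a.Val → b.Val) : Prop :=
  ∃ (p : Prog a b) (T : ℕ), ∀ ω x, ∃ t ≤ T, p.Runs ω x (f x) t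

/-- `ConstTime` for real-valued functions. -/
def ConstTimeReal {a : Ty} (f : a.Val → ℝ) : Prop :=
  ConstTime (a := a) (b := .real) f

namespace ConstTime

variable {a b c d : Ty}

theorem id : ConstTime (fun x : a.Val => x) :=
  ⟨.id a, 1, fun _ _ => ⟨1, le_rfl, rfl, rfl⟩⟩

theorem of_eq {f g : a.Val → b.Val} (hf : ConstTime f) (h : ∀ x, f x = g x) : ConstTime g :=
  funext h ▸ hf

theorem comp {g : b.Val → c.Val} {f : a.Val → b.Val} (hg : ConstTime g) (hf : ConstTime f) :
    ConstTime (fun x => g (f x)) := by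
  obtain ⟨p, T, hp⟩ := hf
  obtain ⟨q, T', hq⟩ := hg
  refine ⟨.comp p q, T + T' + 1, fun ω x => ?_⟩
  obtain ⟨s, hs, hs'⟩ := hp (ω.sub 0) x
  obtain ⟨u, hu, hu'⟩ := hq (ω.sub 1) (f x)
  exact ⟨s + u + 1, by omega, f x, s, u, hs', hu', rfl⟩

theorem pair {f : a.Val → b.Val} {g : a.Val → c.Val} (hf : ConstTime f) (hg : ConstTime g) :
    ConstTime (b := .prod b c) (fun x => (f x, g x)) := by
  obtain ⟨p, T, hp⟩ := hf
  obtain ⟨q, T', hq⟩ := hg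
  refine ⟨.pair p q, T + T' + 1, fun ω x => ?_⟩
  obtain ⟨s, hs, hs'⟩ := hp (ω.sub 0) x
  obtain ⟨u, hu, hu'⟩ := hq (ω.sub 1) x
  exact ⟨s + u + 1, by omega, s, u, hs', hu', rfl⟩

theorem fst {f : a.Val → (Ty.prod b c).Val} (hf : ConstTime f) :
    ConstTime (fun x => (f x).1) :=
  comp (g := fun x : (Ty.prod b c).Val => x.1)
    ⟨.fst b c, 1, fun _ _ => ⟨1, le_rfl, rfl, rfl⟩⟩ hf

theorem snd {f : a.Val → (Ty.prod b c).Val} (hf : ConstTime f) :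
    ConstTime (fun x => (f x).2) :=
  comp (g := fun x : (Ty.prod b c).Val => x.2)
    ⟨.snd b c, 1, fun _ _ => ⟨1, le_rfl, rfl, rfl⟩⟩ hf

theorem inl {f : a.Val → b.Val} (hf : ConstTime f) :
    ConstTime (b := .sum b c) (fun x => Sum.inl (f x)) :=
  comp (c := .sum b c) (g := fun x : b.Val => (Sum.inl x : b.Val ⊕ c.Val))
    ⟨.inl b c, 1, fun _ _ => ⟨1, le_rfl, rfl, rfl⟩⟩ hf

theorem inr {f : a.Val → c.Val} (hf : ConstTime f) :
    ConstTime (b := .sum b c) (fun x => Sum.inr (f x)) :=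
  comp (c := .sum b c) (g := fun x : c.Val => (Sum.inr x : b.Val ⊕ c.Val))
    ⟨.inr b c, 1, fun _ _ => ⟨1, le_rfl, rfl, rfl⟩⟩ hf

theorem sumElim {u : a.Val → (Ty.sum b c).Val} {f : (Ty.prod b a).Val → d.Val}
    {g : (Ty.prod c a).Val → d.Val} (hu : ConstTime u) (hf : ConstTime f) (hg : ConstTime g) :
    ConstTime (fun x => Sum.elim (fun v => f (v, x)) (fun w => g (w, x)) (u x)) := by
  obtain ⟨p, T, hp⟩ := hf
  obtain ⟨q, T', hq⟩ := hg
  have hc : ConstTime (a := .prod (.sum b c) a)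
      (fun z => Sum.elim (fun v => f (v, z.2)) (fun w => g (w, z.2)) z.1) := by
    refine ⟨.cases p q, T + T' + 1, fun ω z => ?_⟩
    obtain ⟨v | w, x⟩ := z
    · obtain ⟨s, hs, hs'⟩ := hp (ω.sub 0) (v, x)
      exact ⟨s + 1, by omega, s, rfl, Or.inl ⟨v, rfl, hs'⟩⟩
    · obtain ⟨s, hs, hs'⟩ := hq (ω.sub 1) (w, x)
      exact ⟨s + 1, by omega, s, rfl, Or.inr ⟨w, rfl, hs'⟩⟩
  exact comp hc (pair hu id)

theorem nil : ConstTime (a := a) (b := .list b) (fun _ => ([] : List b.Val)) :=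
  ⟨.nil a b, 1, fun _ _ => ⟨1, le_rfl, rfl, rfl⟩⟩

theorem cons {f : a.Val → b.Val} {g : a.Val → List b.Val} (hf : ConstTime f)
    (hg : ConstTime (b := .list b) g) :
    ConstTime (b := .list b) (fun x => (f x :: g x : List b.Val)) :=
  comp (a := a) (b := .prod b (.list b)) (c := .list b)
    (g := fun z : b.Val × List b.Val => (z.1 :: z.2 : List b.Val))
    ⟨.cons b, 1, fun _ _ => ⟨1, le_rfl, rfl, rfl⟩⟩ (pair (c := .list b) hf hg)

/-- The head and the tail of a list, if there are any. -/
def unconsVal {α : Type} : List α → Unit ⊕ (α × List α)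
  | [] => Sum.inl ()
  | u :: l => Sum.inr (u, l)

theorem uncons {f : a.Val → List b.Val} (hf : ConstTime (b := .list b) f) :
    ConstTime (b := .sum .unit (.prod b (.list b))) (fun x => unconsVal (f x)) := by
  refine comp (b := .list b) (c := .sum .unit (.prod b (.list b)))
    (g := fun l : List b.Val => unconsVal l) ⟨.uncons b, 1, fun _ l => ⟨1, le_rfl, rfl, ?_⟩⟩ hf
  cases l with
  | nil => exact Or.inl ⟨rfl, rfl⟩
  | cons u l => exact Or.inr ⟨u, l, rfl, rfl⟩

theorem tail {f : a.Val → List b.Val} (hf : ConstTime (b := .list b) f) :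
    ConstTime (b := .list b) (fun x => (f x).tail) := by
  have h := sumElim (b := .unit) (c := .prod b (.list b)) (d := .list b) (uncons hf)
    (f := fun _ => ([] : List b.Val)) (g := fun z => z.1.2) nil (snd (fst id))
  refine h.of_eq fun x => ?_
  cases f x <;> rfl

theorem headD {f : a.Val → List b.Val} {g : a.Val → b.Val} (hf : ConstTime (b := .list b) f)
    (hg : ConstTime g) : ConstTime (fun x => (f x).headD (g x)) := by
  have h := sumElim (b := .unit) (c := .prod b (.list b)) (d := b) (uncons hf) (f := fun z => g z.2)
    (g := fun z => z.1.1) (comp hg (snd id)) (fst (fst id))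
  refine h.of_eq fun x => ?_
  cases f x <;> rfl

theorem getD {f : a.Val → List b.Val} {g : a.Val → b.Val} (hf : ConstTime (b := .list b) f)
    (hg : ConstTime g) (n : ℕ) : ConstTime (fun x => (f x).getD n (g x)) := by
  induction n generalizing f with
  | zero =>
    convert headD hf hg using 2 with x
    cases f x <;> rfl
  | succ n ih =>
    convert ih (tail hf) using 2 with x
    cases f x <;> simp

theorem ofFn {n : ℕ} {f : Fin n → a.Val → b.Val} (hf : ∀ i, ConstTime (f i)) :
    ConstTime (b := .list b) (fun x => (List.ofFn fun i => f i x : List b.Val)) := by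
  induction n with
  | zero => simpa using (nil : ConstTime (a := a) (b := .list b) _)
  | succ n ih => simpa only [List.ofFn_succ] using cons (hf 0) (ih fun i => hf i.succ)

theorem ite_lt {r s : a.Val → ℝ} {f g : a.Val → b.Val} (hr : ConstTimeReal r)
    (hs : ConstTimeReal s) (hf : ConstTime f) (hg : ConstTime g) :
    ConstTime (fun x => if r x < s x then f x else g x) := by
  have hless : ConstTime (a := .prod .real .real) (b := .sum .unit .unit)
      (fun z : ℝ × ℝ => if z.1 < z.2 then (Sum.inl () : Unit ⊕ Unit) else Sum.inr ()) := by
    refine ⟨.less, 1, fun _ z => ⟨1, le_rfl, rfl, ?_⟩⟩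
    by_cases h : @LT.lt ℝ _ z.1 z.2
    · exact Or.inl ⟨h, if_pos h⟩
    · exact Or.inr ⟨h, if_neg h⟩
  have h := sumElim (comp hless (pair (b := .real) (c := .real) hr hs))
    (f := fun z => f z.2) (g := fun z => g z.2) (comp hf (snd id)) (comp hg (snd id))
  convert h using 2 with x
  by_cases hx : r x < s x
  · simp only [hx, if_true]
    rfl
  · simp only [hx, if_false]
    rfl

end ConstTime

namespace ConstTimeReal

variable {a b : Ty}

theorem of_eq {f g : a.Val → ℝ} (hf : ConstTimeReal f) (h : ∀ x, f x = g x) :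
    ConstTimeReal g :=
  funext h ▸ hf

theorem const (q : ℚ) : ConstTimeReal (fun _ : a.Val => (q : ℝ)) :=
  ⟨.const a q, 1, fun _ _ => ⟨1, le_rfl, rfl, rfl⟩⟩

theorem zero : ConstTimeReal (fun _ : a.Val => (0 : ℝ)) :=
  (const 0).of_eq fun _ => Rat.cast_zero

theorem binOp (o : BinOp) {f g : a.Val → ℝ} (hf : ConstTimeReal f) (hg : ConstTimeReal g) :
    ConstTimeReal (fun x => o.apply (f x) (g x)) :=
  ConstTime.comp (b := .prod .real .real) (c := .real) (g := fun z : ℝ × ℝ => o.apply z.1 z.2)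
    ⟨.binOp o, 1, fun _ _ => ⟨1, le_rfl, rfl, rfl⟩⟩ (ConstTime.pair hf hg)

theorem add {f g : a.Val → ℝ} (hf : ConstTimeReal f) (hg : ConstTimeReal g) :
    ConstTimeReal (fun x => f x + g x) := binOp .add hf hg

theorem sub {f g : a.Val → ℝ} (hf : ConstTimeReal f) (hg : ConstTimeReal g) :
    ConstTimeReal (fun x => f x - g x) := binOp .sub hf hg

theorem mul {f g : a.Val → ℝ} (hf : ConstTimeReal f) (hg : ConstTimeReal g) :
    ConstTimeReal (fun x => f x * g x) := binOp .mul hf hg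

theorem div {f g : a.Val → ℝ} (hf : ConstTimeReal f) (hg : ConstTimeReal g) :
    ConstTimeReal (fun x => f x / g x) := binOp .div hf hg

theorem log {f : a.Val → ℝ} (hf : ConstTimeReal f) : ConstTimeReal (fun x => Real.log (f x)) :=
  ConstTime.comp (b := .real) (c := .real) (g := fun z : ℝ => Real.log z)
    ⟨.unOp .log, 1, fun _ _ => ⟨1, le_rfl, rfl, rfl⟩⟩ hf

theorem pow {f : a.Val → ℝ} (hf : ConstTimeReal f) (n : ℕ) :
    ConstTimeReal (fun x => f x ^ n) := by
  induction n with
  | zero => exact (const 1).of_eq fun x => by simp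
  | succ n ih => simpa only [pow_succ] using mul ih hf

theorem sum {ι : Type*} (s : Finset ι) {f : ι → a.Val → ℝ} (hf : ∀ i, ConstTimeReal (f i)) :
    ConstTimeReal (fun x => ∑ i ∈ s, f i x) := by
  classical
  induction s using Finset.induction_on with
  | empty => simpa using zero (a := a)
  | insert i s hi ih => simpa only [Finset.sum_insert hi] using add (hf i) ih

end ConstTimeReal

/-- Brute force over a finite family of candidates: the candidate that minimizes an objective
function is found in constant time. -/
theorem exists_constTime_argmin {a b : Ty} {ι : Type*} [Finite ι] [Nonempty ι]
    {R : ι → a.Val → ℝ} {g : ι → a.Val → b.Val} (hR : ∀ i, ConstTimeReal (R i))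
    (hg : ∀ i, ConstTime (g i)) :
    ∃ h : a.Val → b.Val, ConstTime h ∧ ∀ x, ∃ i, h x = g i x ∧ ∀ j, R i x ≤ R j x := by
  classical
  cases nonempty_fintype ι
  obtain ⟨i₀⟩ := ‹Nonempty ι›
  -- the recursion keeps the value of the objective function next to the best candidate
  have key : ∀ s : Finset ι, ∃ h : a.Val → ℝ × b.Val,
      ConstTime (a := a) (b := .prod .real b) h ∧
        ∀ x, ∃ i, h x = (R i x, g i x) ∧ ∀ j ∈ s, R i x ≤ R j x := by
    intro s
    induction s using Finset.induction_on with
    | empty =>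
      exact ⟨fun x => (R i₀ x, g i₀ x), ConstTime.pair (b := .real) (hR i₀) (hg i₀),
        fun x => ⟨i₀, rfl, by simp⟩⟩
    | insert i s _ ih =>
      obtain ⟨h, hh, hmin⟩ := ih
      refine ⟨fun x => if R i x < (h x).1 then (R i x, g i x) else h x,
        ConstTime.ite_lt (b := .prod .real b) (hR i) (ConstTime.fst (b := .real) hh)
          (ConstTime.pair (b := .real) (hR i) (hg i)) hh, fun x => ?_⟩
      obtain ⟨j, hj, hj'⟩ := hmin x
      by_cases hlt : R i x < R j x
      · refine ⟨i, by simp [hj, hlt], fun k hk => ?_⟩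
        rcases Finset.mem_insert.1 hk with rfl | hk
        · exact le_rfl
        · exact hlt.le.trans (hj' k hk)
      · refine ⟨j, by simp [hj, hlt], fun k hk => ?_⟩
        rcases Finset.mem_insert.1 hk with rfl | hk
        · exact not_lt.1 hlt
        · exact hj' k hk
  obtain ⟨h, hh, hmin⟩ := key Finset.univ
  refine ⟨fun x => (h x).2, ConstTime.snd (b := .real) hh, fun x => ?_⟩
  obtain ⟨i, hi, hi'⟩ := hmin x
  exact ⟨i, by simp [hi], fun j => hi' j (Finset.mem_univ j)⟩

/-! ### Loops over lists -/

/-- A left fold with a constant-time step takes linear time. -/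
theorem exists_prog_foldl {a b : Ty} {f : a.Val × b.Val → b.Val}
    (hf : ConstTime (a := .prod a b) f) :
    ∃ (p : Prog (.prod (.list a) b) b) (T : ℕ), ∀ ω (l : List a.Val) (s : b.Val),
      ∃ t ≤ T * (l.length + 1), p.Runs ω (l, s) (l.foldl (fun s u => f (u, s)) s) t := by
  have hbody := ConstTime.sumElim (a := .prod (.list a) b) (b := .unit) (c := .prod a (.list a))
    (d := .sum (.prod (.list a) b) b)
    (ConstTime.uncons (b := a) (ConstTime.fst (b := .list a) ConstTime.id))
    (f := fun z => Sum.inr z.2.2)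
    (g := fun z => Sum.inl (z.1.2, f (z.1.1, z.2.2)))
    (ConstTime.inr (ConstTime.snd (ConstTime.snd ConstTime.id)))
    (ConstTime.inl (ConstTime.pair (ConstTime.snd (ConstTime.fst ConstTime.id))
      (ConstTime.comp hf (ConstTime.pair (ConstTime.fst (ConstTime.fst ConstTime.id))
        (ConstTime.snd (ConstTime.snd ConstTime.id))))))
  obtain ⟨p, T, hp⟩ := hbody
  refine ⟨.loop p, T + 1, fun ω l s => ?_⟩
  let z : ℕ → List a.Val × b.Val := fun k =>
    (l.drop k, (l.take k).foldl (fun s u => f (u, s)) s)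
  choose τ hτ hrun using fun k => hp (ω.sub k) (z k)
  refine ⟨∑ k ∈ Finset.range (l.length + 1), (τ k + 1), ?_, l.length, z, τ, by simp [z]; rfl,
    fun k hk => ?_, ?_, rfl⟩
  · calc ∑ k ∈ Finset.range (l.length + 1), (τ k + 1)
        ≤ ∑ _k ∈ Finset.range (l.length + 1), (T + 1) :=
          Finset.sum_le_sum fun k _ => Nat.succ_le_succ (hτ k)
      _ = (T + 1) * (l.length + 1) := by simp [mul_comm]
  · convert hrun k using 1
    have h1 : l.drop k = l[k] :: l.drop (k + 1) := List.drop_eq_getElem_cons hk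
    have h2 : l.take (k + 1) = l.take k ++ [l[k]] := by simp
    simp only [z, h1, h2, List.foldl_append, ConstTime.unconsVal]
    rfl
  · have h1 : z l.length = ([], l.foldl (fun s u => f (u, s)) s) := by simp [z]
    have h2 := hrun l.length
    rw [h1] at h2 ⊢
    exact h2

/-- Applying a constant-time function to all elements of a list takes linear time. -/
theorem exists_prog_map {a b : Ty} {g : a.Val → b.Val} (hg : ConstTime g) :
    ∃ (p : Prog (.list a) (.list b)) (T : ℕ), ∀ ω (l : List a.Val),
      ∃ t ≤ T * (l.length + 1), p.Runs ω l (l.map g : List b.Val) t := by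
  -- folding with `cons` reverses the list, so this is done twice
  obtain ⟨p, T, hp⟩ := exists_prog_foldl (a := a) (b := .list b)
    (f := fun z : a.Val × List b.Val => (g z.1 :: z.2 : List b.Val))
    (ConstTime.cons (ConstTime.comp hg (ConstTime.fst ConstTime.id))
      (ConstTime.snd (c := .list b) ConstTime.id))
  obtain ⟨q, T', hq⟩ := exists_prog_foldl (a := b) (b := .list b)
    (f := fun z : b.Val × List b.Val => (z.1 :: z.2 : List b.Val))
    (ConstTime.cons (ConstTime.fst ConstTime.id) (ConstTime.snd (c := .list b) ConstTime.id))
  have hrev : ∀ (l : List a.Val) (s : List b.Val),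
      l.foldl (fun s u => g u :: s) s = (l.map g).reverse ++ s := by
    intro l
    induction l with
    | nil => simp
    | cons u l ih => intro s; simp [ih]
  refine ⟨.comp (.pair (.comp (.pair (.id _) (.nil _ b)) p) (.nil _ b)) q,
    T + T' + 8, fun ω l => ?_⟩
  obtain ⟨s, hs, hs'⟩ := hp (((ω.sub 0).sub 0).sub 1) l ([] : List b.Val)
  obtain ⟨u, hu, hu'⟩ := hq (ω.sub 1) (l.map g).reverse ([] : List b.Val)
  have hl := hrev l []
  rw [List.append_nil] at hl
  replace hs' : p.Runs (((ω.sub 0).sub 0).sub 1) (l, []) ((l.map g).reverse : List b.Val) s :=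
    (congrArg (fun y : List b.Val => p.Runs (((ω.sub 0).sub 0).sub 1) (l, []) y s) hl).mp hs'
  refine ⟨_, ?_, ((l.map g).reverse, ([] : List b.Val)), _, u,
    ⟨_, _, ⟨(l, ([] : List b.Val)), _, s, ⟨1, 1, ⟨rfl, rfl⟩, ⟨rfl, rfl⟩, rfl⟩, hs', rfl⟩,
      ⟨rfl, rfl⟩, rfl⟩, ?_, rfl⟩
  · simp only [List.length_reverse, List.length_map] at hu
    nlinarith
  · have hl' : ∀ m s : List b.Val, m.foldl (fun s u => u :: s) s = m.reverse ++ s := by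
      intro m
      induction m with
      | nil => simp
      | cons u m ih => intro s; simp [ih]
    have hm := hl' (l.map g).reverse []
    rw [List.append_nil, List.reverse_reverse] at hm
    exact (congrArg (fun y : List b.Val =>
      q.Runs (ω.sub 1) ((l.map g).reverse, []) y u) hm).mp hu'

/-! ### Directions on a curve and interpolation -/

open Polynomial in
/-- Coefficients of polynomials of bounded degree are rational linear combinations of the values
at natural numbers. -/
theorem exists_rat_coeff_eq_sum {N : ℕ} (T : Finset (Fin N)) :
    ∃ a : ℕ → Fin N → ℚ, ∀ P : ℝ[X], P.natDegree < T.card →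
      ∀ m, P.coeff m = ∑ k ∈ T, (a m k : ℝ) * P.eval ((k : ℕ) : ℝ) := by
  refine ⟨fun m k => (Lagrange.basis T (fun k : Fin N => ((k : ℕ) : ℚ)) k).coeff m,
    fun P hP m => ?_⟩
  have hinj : Set.InjOn (fun k : Fin N => ((k : ℕ) : ℝ)) T := fun k _ l _ h => by
    simpa [Fin.ext_iff] using h
  have hmap : ∀ k, Lagrange.basis T (fun k : Fin N => ((k : ℕ) : ℝ)) k =
      (Lagrange.basis T (fun k : Fin N => ((k : ℕ) : ℚ)) k).map (algebraMap ℚ ℝ) := by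
    intro k
    simp [Lagrange.basis, Lagrange.basisDivisor, Polynomial.map_prod]
  have hdeg : P.degree < T.card :=
    lt_of_le_of_lt Polynomial.degree_le_natDegree (by exact_mod_cast hP)
  conv_lhs => rw [Lagrange.eq_interpolate hinj hdeg, Lagrange.interpolate_apply,
    Polynomial.finsetSum_coeff]
  refine Finset.sum_congr rfl fun k _ => ?_
  rw [Polynomial.coeff_C_mul, hmap, Polynomial.coeff_map, mul_comm]
  rfl

/-- Exponents of the curve of directions. Their pairwise sums are distinct, so that a quadratic
form can be read off from the coefficients of its restriction to the curve. -/
def expo : Fin 4 → ℕ := ![0, 1, 4, 6]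

theorem expo_le (j : Fin 4) : expo j ≤ 6 := by fin_cases j <;> simp [expo]

theorem expo_injective : Function.Injective expo := by decide

theorem expo_add_eq_iff (i j i' j' : Fin 4) :
    expo i + expo j = expo i' + expo j' ↔ (i = i' ∧ j = j') ∨ (i = j' ∧ j = i') := by
  revert i j i' j'
  decide

/-- The direction `(1, k, k⁴, k⁶)`. -/
def dir (k : Fin 25) (j : Fin 4) : ℚ := ((k : ℕ) : ℚ) ^ expo j

/-- The linear form given by the direction `dir k`. -/
def linForm (k : Fin 25) (u : Fin 4 → ℝ) : ℝ := ∑ j, (dir k j : ℝ) * u j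

/-- The quadratic form of a matrix at the direction `dir k`. -/
def quadForm (k : Fin 25) (S : Matrix (Fin 4) (Fin 4) ℝ) : ℝ :=
  ∑ i, ∑ j, (dir k i : ℝ) * (dir k j : ℝ) * S i j

theorem linForm_sub (k : Fin 25) (u v : Fin 4 → ℝ) :
    linForm k (u - v) = linForm k u - linForm k v := by
  simp [linForm, mul_sub]

theorem quadForm_sub (k : Fin 25) (S R : Matrix (Fin 4) (Fin 4) ℝ) :
    quadForm k (S - R) = quadForm k S - quadForm k R := by
  simp [quadForm, mul_sub]

/-- Vectors are recovered from the values of the linear forms at any 13 directions. -/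
theorem exists_rat_eq_sum_linForm (T : Finset (Fin 25)) (hT : 13 ≤ T.card) :
    ∃ a : Fin 4 → Fin 25 → ℚ, ∀ u j, u j = ∑ k ∈ T, (a j k : ℝ) * linForm k u := by
  obtain ⟨a, ha⟩ := exists_rat_coeff_eq_sum T
  refine ⟨fun j => a (expo j), fun u j => ?_⟩
  let P : Polynomial ℝ := ∑ j, Polynomial.C (u j) * Polynomial.X ^ expo j
  have hdeg : P.natDegree < T.card := by
    refine lt_of_le_of_lt (Polynomial.natDegree_sum_le_of_forall_le _ _ (n := 6) fun j _ => ?_)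
      (by omega)
    exact (Polynomial.natDegree_C_mul_X_pow_le _ _).trans (expo_le j)
  have heval : ∀ k : Fin 25, P.eval ((k : ℕ) : ℝ) = linForm k u := fun k => by
    simp only [P, linForm, dir, Polynomial.eval_finsetSum, Polynomial.eval_mul,
      Polynomial.eval_C, Polynomial.eval_pow, Polynomial.eval_X, Rat.cast_pow, Rat.cast_natCast]
    exact Finset.sum_congr rfl fun j _ => mul_comm _ _
  have hcoeff : P.coeff (expo j) = u j := by
    simp [P, Polynomial.finsetSum_coeff, Polynomial.coeff_X_pow, expo_injective.eq_iff]
  rw [← hcoeff, ha P hdeg]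
  simp only [heval]

/-- Symmetric matrices are recovered from the values of their quadratic forms at any 13
directions. -/
theorem exists_rat_eq_sum_quadForm (T : Finset (Fin 25)) (hT : 13 ≤ T.card) :
    ∃ b : Fin 4 → Fin 4 → Fin 25 → ℚ, (∀ i j, b i j = b j i) ∧
      ∀ S : Matrix (Fin 4) (Fin 4) ℝ, S.IsSymm → ∀ i j,
        S i j = ∑ k ∈ T, (b i j k : ℝ) * quadForm k S := by
  obtain ⟨a, ha⟩ := exists_rat_coeff_eq_sum T
  -- off the diagonal, two equal entries contribute to a coefficient
  refine ⟨fun i j k => (if i = j then 1 else 1 / 2) * a (expo i + expo j) k,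
    fun i j => by simp only [add_comm (expo i), eq_comm (a := i)], fun S hS i j => ?_⟩
  let P : Polynomial ℝ :=
    ∑ i, ∑ j, Polynomial.C (S i j) * Polynomial.X ^ (expo i + expo j)
  have hdeg : P.natDegree < T.card := by
    refine lt_of_le_of_lt (Polynomial.natDegree_sum_le_of_forall_le _ _ (n := 12) fun i _ =>
      Polynomial.natDegree_sum_le_of_forall_le _ _ fun j _ => ?_) (by omega)
    refine (Polynomial.natDegree_C_mul_X_pow_le _ _).trans ?_
    have := expo_le i
    have := expo_le j
    omega
  have heval : ∀ k : Fin 25, P.eval ((k : ℕ) : ℝ) = quadForm k S := fun k => by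
    simp only [P, quadForm, dir, Polynomial.eval_finsetSum, Polynomial.eval_mul,
      Polynomial.eval_C, Polynomial.eval_pow, Polynomial.eval_X, pow_add]
    push_cast
    exact Finset.sum_congr rfl fun i _ => Finset.sum_congr rfl fun j _ => by ring
  have hcoeff : P.coeff (expo i + expo j) = if i = j then S i j else 2 * S i j := by
    have h1 : P.coeff (expo i + expo j) =
        ∑ i', ∑ j', if (i = i' ∧ j = j') ∨ (i = j' ∧ j = i') then S i' j' else 0 := by
      simp [P, Polynomial.finsetSum_coeff, Polynomial.coeff_X_pow, expo_add_eq_iff]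
    have hs : ∀ i j, S i j = S j i := fun i j => hS.apply j i
    rw [h1]
    fin_cases i <;> fin_cases j <;> simp [Fin.sum_univ_four] <;> grind
  have h := ha P hdeg (expo i + expo j)
  simp only [heval, hcoeff] at h
  push_cast
  simp only [mul_assoc, ← Finset.mul_sum, ← h]
  split_ifs <;> simp

/-- Vectors and symmetric matrices depend stably on the values of their linear and quadratic forms
at any 13 directions. -/
theorem exists_stability_bound : ∃ K : ℝ, 1 ≤ K ∧ ∀ T : Finset (Fin 25), 13 ≤ T.card →
    (∀ (u : Fin 4 → ℝ) (r : ℝ), (∀ k ∈ T, |linForm k u| ≤ r) → ∀ j, |u j| ≤ K * r) ∧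
    (∀ (S : Matrix (Fin 4) (Fin 4) ℝ), S.IsSymm → ∀ r : ℝ, (∀ k ∈ T, |quadForm k S| ≤ r) →
      ∀ i j, |S i j| ≤ K * r) := by
  have hsum : ∀ (T : Finset (Fin 25)) (a g : Fin 25 → ℝ) (K r : ℝ), ∑ k ∈ T, |a k| ≤ K →
      13 ≤ T.card → (∀ k ∈ T, |g k| ≤ r) → |∑ k ∈ T, a k * g k| ≤ K * r := by
    intro T a g K r hK hT hr
    obtain ⟨k, hk⟩ : T.Nonempty := Finset.card_pos.1 (by omega)
    have hr0 : 0 ≤ r := (abs_nonneg _).trans (hr k hk)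
    calc |∑ k ∈ T, a k * g k| ≤ ∑ k ∈ T, |a k| * r :=
          (Finset.abs_sum_le_sum_abs _ _).trans (Finset.sum_le_sum fun k hk => by
            rw [abs_mul]
            exact mul_le_mul_of_nonneg_left (hr k hk) (abs_nonneg _))
      _ ≤ K * r := by
          rw [← Finset.sum_mul]
          exact mul_le_mul_of_nonneg_right hK hr0
  have key : ∀ T : Finset (Fin 25), ∃ K : ℝ, 13 ≤ T.card → ∀ K' ≥ K,
      (∀ (u : Fin 4 → ℝ) (r : ℝ), (∀ k ∈ T, |linForm k u| ≤ r) → ∀ j, |u j| ≤ K' * r) ∧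
      (∀ (S : Matrix (Fin 4) (Fin 4) ℝ), S.IsSymm → ∀ r : ℝ, (∀ k ∈ T, |quadForm k S| ≤ r) →
        ∀ i j, |S i j| ≤ K' * r) := by
    intro T
    by_cases hT : 13 ≤ T.card
    swap
    · exact ⟨0, fun h => absurd h hT⟩
    obtain ⟨a, ha⟩ := exists_rat_eq_sum_linForm T hT
    obtain ⟨b, -, hb⟩ := exists_rat_eq_sum_quadForm T hT
    obtain ⟨K₁, hK₁⟩ := (Set.finite_range fun j => ∑ k ∈ T, |(a j k : ℝ)|).bddAbove
    obtain ⟨K₂, hK₂⟩ :=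
      (Set.finite_range fun ij : Fin 4 × Fin 4 => ∑ k ∈ T, |(b ij.1 ij.2 k : ℝ)|).bddAbove
    refine ⟨max K₁ K₂, fun _ K' hK' => ⟨fun u r hr j => ?_, fun S hS r hr i j => ?_⟩⟩
    · rw [ha u j]
      exact hsum T _ _ _ _ ((hK₁ ⟨j, rfl⟩).trans ((le_max_left _ _).trans hK')) hT hr
    · rw [hb S hS i j]
      exact hsum T _ _ _ _ ((hK₂ ⟨(i, j), rfl⟩).trans ((le_max_right _ _).trans hK')) hT hr
  choose K hK using key
  obtain ⟨K₀, hK₀⟩ := (Set.finite_range K).bddAbove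
  exact ⟨max K₀ 1, le_max_right _ _, fun T hT =>
    hK T hT _ ((hK₀ ⟨T, rfl⟩).trans (le_max_left _ _))⟩

theorem abs_apply_le_entryNorm {d : ℕ} (S : Matrix (Fin d) (Fin d) ℝ) (i j : Fin d) :
    |S i j| ≤ entryNorm S :=
  norm_le_pi_norm (fun ij : Fin d × Fin d => S ij.1 ij.2) (i, j)

theorem entryNorm_nonneg {d : ℕ} (S : Matrix (Fin d) (Fin d) ℝ) : 0 ≤ entryNorm S :=
  norm_nonneg _

theorem entryNorm_le {d : ℕ} {S : Matrix (Fin d) (Fin d) ℝ} {r : ℝ} (hr : 0 ≤ r)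
    (h : ∀ i j, |S i j| ≤ r) : entryNorm S ≤ r :=
  (pi_norm_le_iff_of_nonneg hr).2 fun ij => h ij.1 ij.2

/-- The linear and quadratic forms at all directions are bounded. -/
theorem exists_form_bound : ∃ L : ℝ, 1 ≤ L ∧
    (∀ k u, |linForm k u| ≤ L * ‖u‖) ∧ (∀ k S, |quadForm k S| ≤ L ^ 2 * entryNorm S) := by
  obtain ⟨L₀, hL₀⟩ := (Set.finite_range fun k => ∑ j, |(dir k j : ℝ)|).bddAbove
  have hL : ∀ k, ∑ j, |(dir k j : ℝ)| ≤ max L₀ 1 := fun k =>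
    (hL₀ ⟨k, rfl⟩).trans (le_max_left _ _)
  refine ⟨max L₀ 1, le_max_right _ _, fun k u => ?_, fun k S => ?_⟩
  · calc |linForm k u| ≤ ∑ j, |(dir k j : ℝ)| * ‖u‖ := by
          refine (Finset.abs_sum_le_sum_abs _ _).trans (Finset.sum_le_sum fun j _ => ?_)
          rw [abs_mul]
          exact mul_le_mul_of_nonneg_left (norm_le_pi_norm u j) (abs_nonneg _)
      _ ≤ _ := by
          rw [← Finset.sum_mul]
          exact mul_le_mul_of_nonneg_right (hL k) (norm_nonneg _)
  · calc |quadForm k S| ≤ ∑ i, ∑ j, |(dir k i : ℝ)| * |(dir k j : ℝ)| * entryNorm S := by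
          refine (Finset.abs_sum_le_sum_abs _ _).trans (Finset.sum_le_sum fun i _ =>
            (Finset.abs_sum_le_sum_abs _ _).trans (Finset.sum_le_sum fun j _ => ?_))
          rw [abs_mul, abs_mul]
          exact mul_le_mul_of_nonneg_left (abs_apply_le_entryNorm S i j) (by positivity)
      _ = (∑ j, |(dir k j : ℝ)|) ^ 2 * entryNorm S := by
          rw [sq, Finset.sum_mul_sum]
          simp only [Finset.sum_mul]
      _ ≤ _ := by
          gcongr
          · exact entryNorm_nonneg S
          · exact hL k

theorem quadForm_nonneg (k : Fin 25) {S : Matrix (Fin 4) (Fin 4) ℝ} (hS : S.PosSemidef) :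
    0 ≤ quadForm k S := by
  have h := hS.dotProduct_mulVec_nonneg (fun j => (dir k j : ℝ))
  refine h.trans_eq ?_
  simp only [quadForm, dotProduct, Matrix.mulVec, Finset.mul_sum, Pi.star_apply, star_trivial]
  exact Finset.sum_congr rfl fun i _ => Finset.sum_congr rfl fun j _ => by ring

/-- Adding a sufficiently large multiple of the identity makes a perturbation of a positive
semidefinite matrix positive semidefinite. -/
theorem posSemidef_of_near {S R : Matrix (Fin 4) (Fin 4) ℝ} (hS : S.PosSemidef) (hR : R.IsSymm)
    {e s : ℝ} (he : ∀ i j, |R i j - S i j| ≤ e) (hs : 4 * e ≤ s) :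
    (R + s • (1 : Matrix (Fin 4) (Fin 4) ℝ)).PosSemidef := by
  refine Matrix.PosSemidef.of_dotProduct_mulVec_nonneg ?_ fun x => ?_
  · exact Matrix.IsSymm.add hR ((Matrix.isSymm_one).smul s)
  have h0 := hS.dotProduct_mulVec_nonneg x
  have he0 : 0 ≤ e := (abs_nonneg _).trans (he 0 0)
  have hE : |∑ i, ∑ j, x i * x j * (R i j - S i j)| ≤ e * (∑ i, |x i|) ^ 2 := by
    calc |∑ i, ∑ j, x i * x j * (R i j - S i j)|
        ≤ ∑ i, ∑ j, |x i| * |x j| * e := by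
          refine (Finset.abs_sum_le_sum_abs _ _).trans (Finset.sum_le_sum fun i _ =>
            (Finset.abs_sum_le_sum_abs _ _).trans (Finset.sum_le_sum fun j _ => ?_))
          rw [abs_mul, abs_mul]
          exact mul_le_mul_of_nonneg_left (he i j) (by positivity)
      _ = _ := by simp only [sq, Finset.sum_mul_sum, ← Finset.sum_mul]; ring
  have hC : (∑ i, |x i|) ^ 2 ≤ 4 * ∑ i, x i ^ 2 := by
    have := sq_sum_le_card_mul_sum_sq (s := Finset.univ) (f := fun i : Fin 4 => |x i|)
    simpa using this
  have hsplit : star x ⬝ᵥ (R + s • (1 : Matrix (Fin 4) (Fin 4) ℝ)).mulVec x =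
      star x ⬝ᵥ S.mulVec x + ∑ i, ∑ j, x i * x j * (R i j - S i j) + s * ∑ i, x i ^ 2 := by
    rw [Matrix.add_mulVec, Matrix.smul_mulVec, Matrix.one_mulVec, dotProduct_add]
    simp only [dotProduct, Matrix.mulVec, Fin.sum_univ_four, Pi.star_apply, star_trivial,
      Pi.smul_apply, smul_eq_mul]
    ring
  rw [hsplit]
  have h1 := (abs_le.1 hE).1
  have h2 : e * (∑ i, |x i|) ^ 2 ≤ s * ∑ i, x i ^ 2 := by
    have h3 : 0 ≤ ∑ i, x i ^ 2 := Finset.sum_nonneg fun i _ => sq_nonneg _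
    nlinarith [mul_le_mul_of_nonneg_left hC he0, mul_le_mul_of_nonneg_right hs h3]
  linarith

/-! ### Reconstruction from one-dimensional projections -/

/-- The means interpolated from the means `m` of the projections, when the two components of the
projection to `dir k` are labelled by `π k`. The coefficients `a` are those of an interpolation
formula. -/
def reMean (a : Fin 4 → Fin 25 → ℚ) (m : Fin 25 → Fin 2 → ℝ) (π : Fin 25 → Equiv.Perm (Fin 2))
    (i : Fin 2) : Fin 4 → ℝ :=
  fun j => ∑ k, (a j k : ℝ) * m k (π k i)

/-- The covariance matrices interpolated from the variances `s` of the projections. -/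
def reCov (b : Fin 4 → Fin 4 → Fin 25 → ℚ) (s : Fin 25 → Fin 2 → ℝ)
    (π : Fin 25 → Equiv.Perm (Fin 2)) (i : Fin 2) : Matrix (Fin 4) (Fin 4) ℝ :=
  Matrix.of fun j l => ∑ k, (b j l k : ℝ) * s k (π k i)

/-- The misfit between the data and the projections of the interpolated parameters; the powers
give both summands the same homogeneity. -/
def residual (a : Fin 4 → Fin 25 → ℚ) (b : Fin 4 → Fin 4 → Fin 25 → ℚ)
    (m s : Fin 25 → Fin 2 → ℝ) (π : Fin 25 → Equiv.Perm (Fin 2)) : ℝ :=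
  ∑ i, ∑ k, ((linForm k (reMean a m π i) - m k (π k i)) ^ 4 +
    (quadForm k (reCov b s π i) - s k (π k i)) ^ 2)

/-- An estimate of the size of the parameters from the parameters of the projections. It does not
depend on the labelling. -/
def scaleEst (m s : Fin 25 → Fin 2 → ℝ) : ℝ :=
  ∑ k, ((m k 0 - m k 1) ^ 2 + s k 0 + s k 1)

/-- Up to labelling, the numbers `m` and `s` are the means and variances of the projections of
components with means `μ` and covariances `S`, up to errors `r` and `r ^ 2`. -/
def ApproxProj (r : ℝ) (μ : Fin 2 → Fin 4 → ℝ) (S : Fin 2 → Matrix (Fin 4) (Fin 4) ℝ)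
    (m s : Fin 25 → Fin 2 → ℝ) : Prop :=
  ∀ k, ∃ τ : Equiv.Perm (Fin 2), ∀ i,
    |linForm k (μ i) - m k (τ i)| ≤ r ∧ |quadForm k (S i) - s k (τ i)| ≤ r ^ 2

/-- If the true labelling fits the data, then the best labelling agrees with it, up to a global
relabelling, at 13 or more of the 25 directions, so the best labelling gives almost the true
parameters. -/
theorem exists_reconstruction_bound {a : Fin 4 → Fin 25 → ℚ} {b : Fin 4 → Fin 4 → Fin 25 → ℚ}
    (ha : ∀ (u : Fin 4 → ℝ) j, u j = ∑ k, (a j k : ℝ) * linForm k u)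
    (hbs : ∀ i j, b i j = b j i)
    (hb : ∀ S : Matrix (Fin 4) (Fin 4) ℝ, S.IsSymm → ∀ i j,
        S i j = ∑ k, (b i j k : ℝ) * quadForm k S) :
    ∃ K : ℝ, 1 ≤ K ∧ ∀ (r : ℝ) (μ : Fin 2 → Fin 4 → ℝ) (S : Fin 2 → Matrix (Fin 4) (Fin 4) ℝ)
      (m s : Fin 25 → Fin 2 → ℝ) (π : Fin 25 → Equiv.Perm (Fin 2)), 0 ≤ r →
      (∀ i, (S i).IsSymm) → ApproxProj r μ S m s →
      (∀ π', residual a b m s π ≤ residual a b m s π') →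
      ∃ ρ : Equiv.Perm (Fin 2), ∀ i, (∀ j, |μ i j - reMean a m π (ρ i) j| ≤ K * r) ∧
        ∀ j l, |S i j l - reCov b s π (ρ i) j l| ≤ K * r ^ 2 := by
  obtain ⟨K₀, hK₀, hstab⟩ := exists_stability_bound
  obtain ⟨L, hL, hlin, hquad⟩ := exists_form_bound
  obtain ⟨A, hA, hAa, hAb⟩ : ∃ A : ℝ, 1 ≤ A ∧ (∀ j, ∑ k, |(a j k : ℝ)| ≤ A) ∧
      ∀ j l, ∑ k, |(b j l k : ℝ)| ≤ A := by
    obtain ⟨A₁, hA₁⟩ := (Set.finite_range fun j => ∑ k, |(a j k : ℝ)|).bddAbove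
    obtain ⟨A₂, hA₂⟩ :=
      (Set.finite_range fun ij : Fin 4 × Fin 4 => ∑ k, |(b ij.1 ij.2 k : ℝ)|).bddAbove
    exact ⟨max 1 (max A₁ A₂), le_max_left _ _,
      fun j => (hA₁ ⟨j, rfl⟩).trans ((le_max_left _ _).trans (le_max_right _ _)),
      fun j l => (hA₂ ⟨(j, l), rfl⟩).trans ((le_max_right _ _).trans (le_max_right _ _))⟩
  set W : ℝ := L ^ 2 * A + 1 with hW
  have hL2 : 1 ≤ L ^ 2 := one_le_pow₀ hL
  have hLW : L * A + 1 ≤ W := by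
    have : L ≤ L ^ 2 := by nlinarith
    have := mul_le_mul_of_nonneg_right this (zero_le_one.trans hA)
    linarith
  have hW1 : 1 ≤ W := by nlinarith
  -- the residual has `2 * 25` terms, each at most `2 * W ^ 4 * r ^ 4` at the true labelling
  set K₂ : ℝ := 100 * W ^ 2 with hK₂
  have hK₂1 : 1 ≤ K₂ := by nlinarith
  refine ⟨K₀ * (1 + K₂), by nlinarith, fun r μ S m s π hr hS happ hmin => ?_⟩
  choose τ hτ using happ
  have hsum : ∀ (c g : Fin 25 → ℝ) (q : ℝ), 0 ≤ q → ∑ k, |c k| ≤ A → (∀ k, |g k| ≤ q) →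
      |∑ k, c k * g k| ≤ A * q := by
    intro c g q hq hc hg
    calc |∑ k, c k * g k| ≤ ∑ k, |c k| * q :=
          (Finset.abs_sum_le_sum_abs _ _).trans (Finset.sum_le_sum fun k _ => by
            rw [abs_mul]
            exact mul_le_mul_of_nonneg_left (hg k) (abs_nonneg _))
      _ ≤ A * q := by
          rw [← Finset.sum_mul]
          exact mul_le_mul_of_nonneg_right hc hq
  -- the true labelling reproduces the data
  have hfit : ∀ i k, |linForm k (reMean a m τ i) - m k (τ k i)| ≤ W * r ∧
      |quadForm k (reCov b s τ i) - s k (τ k i)| ≤ W * r ^ 2 := by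
    intro i k
    have h1 : ‖μ i - reMean a m τ i‖ ≤ A * r := by
      refine (pi_norm_le_iff_of_nonneg (by positivity)).2 fun j => ?_
      have : (μ i - reMean a m τ i) j =
          ∑ k, (a j k : ℝ) * (linForm k (μ i) - m k (τ k i)) := by
        rw [Pi.sub_apply, ha (μ i) j]
        simp only [reMean, mul_sub, Finset.sum_sub_distrib]
      rw [this]
      exact hsum _ _ _ hr (hAa j) fun k => (hτ k i).1
    have h2 : entryNorm (S i - reCov b s τ i) ≤ A * r ^ 2 := by
      refine entryNorm_le (by positivity) fun j l => ?_
      have : (S i - reCov b s τ i) j l =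
          ∑ k, (b j l k : ℝ) * (quadForm k (S i) - s k (τ k i)) := by
        rw [Matrix.sub_apply, hb (S i) (hS i) j l]
        simp only [reCov, Matrix.of_apply, mul_sub, Finset.sum_sub_distrib]
      rw [this]
      exact hsum _ _ _ (by positivity) (hAb j l) fun k => (hτ k i).2
    have h3 := hlin k (μ i - reMean a m τ i)
    have h4 := hquad k (S i - reCov b s τ i)
    rw [linForm_sub] at h3
    rw [quadForm_sub] at h4
    have h5 : L * ‖μ i - reMean a m τ i‖ ≤ L * (A * r) := by gcongr
    have h6 : L ^ 2 * entryNorm (S i - reCov b s τ i) ≤ L ^ 2 * (A * r ^ 2) := by gcongr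
    have h7 : (L * A + 1) * r ≤ W * r := mul_le_mul_of_nonneg_right hLW hr
    obtain ⟨h8, h9⟩ := hτ k i
    rw [abs_le] at h3 h4 h8 h9
    refine ⟨abs_le.2 ⟨?_, ?_⟩, abs_le.2 ⟨?_, ?_⟩⟩ <;> nlinarith
  have hres : residual a b m s τ ≤ 100 * W ^ 4 * r ^ 4 := by
    calc residual a b m s τ ≤ ∑ _i : Fin 2, ∑ _k : Fin 25, (2 * W ^ 4 * r ^ 4) := by
          refine Finset.sum_le_sum fun i _ => Finset.sum_le_sum fun k _ => ?_
          obtain ⟨h1, h2⟩ := hfit i k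
          have h3 : (linForm k (reMean a m τ i) - m k (τ k i)) ^ 4 ≤ (W * r) ^ 4 := by
            rw [← Even.pow_abs (by decide : Even 4)]
            exact pow_le_pow_left₀ (abs_nonneg _) h1 4
          have h4 : (quadForm k (reCov b s τ i) - s k (τ k i)) ^ 2 ≤ (W * r ^ 2) ^ 2 := by
            rw [← sq_abs]
            exact pow_le_pow_left₀ (abs_nonneg _) h2 2
          have h5 : W ^ 2 ≤ W ^ 4 := pow_le_pow_right₀ hW1 (by norm_num)
          have h6 : W ^ 2 * r ^ 4 ≤ W ^ 4 * r ^ 4 := by gcongr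
          nlinarith
      _ = _ := by
          simp only [Finset.sum_const, Finset.card_univ, Fintype.card_fin, nsmul_eq_mul]
          push_cast
          ring
  -- hence so does the best labelling
  have hbest : ∀ i k, |linForm k (reMean a m π i) - m k (π k i)| ≤ K₂ * r ∧
      |quadForm k (reCov b s π i) - s k (π k i)| ≤ K₂ * r ^ 2 := by
    intro i k
    have hnn : ∀ i k, 0 ≤ (linForm k (reMean a m π i) - m k (π k i)) ^ 4 +
        (quadForm k (reCov b s π i) - s k (π k i)) ^ 2 := fun i k => by positivity
    have h1 : (linForm k (reMean a m π i) - m k (π k i)) ^ 4 +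
        (quadForm k (reCov b s π i) - s k (π k i)) ^ 2 ≤ 100 * W ^ 4 * r ^ 4 :=
      calc _ ≤ ∑ k, ((linForm k (reMean a m π i) - m k (π k i)) ^ 4 +
            (quadForm k (reCov b s π i) - s k (π k i)) ^ 2) :=
            Finset.single_le_sum (f := fun k => (linForm k (reMean a m π i) - m k (π k i)) ^ 4 +
              (quadForm k (reCov b s π i) - s k (π k i)) ^ 2)
              (fun k _ => hnn i k) (Finset.mem_univ k)
        _ ≤ residual a b m s π :=
            Finset.single_le_sum (f := fun i => ∑ k,
              ((linForm k (reMean a m π i) - m k (π k i)) ^ 4 +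
              (quadForm k (reCov b s π i) - s k (π k i)) ^ 2))
              (fun i _ => Finset.sum_nonneg fun k _ => hnn i k) (Finset.mem_univ i)
        _ ≤ _ := (hmin τ).trans hres
    have h2 : 100 * W ^ 4 * r ^ 4 ≤ (K₂ * r ^ 2) ^ 2 := by
      rw [hK₂]
      have : 0 ≤ W ^ 4 * r ^ 4 := by positivity
      nlinarith
    have h3 : (K₂ * r ^ 2) ^ 2 ≤ (K₂ * r) ^ 4 := by
      have : K₂ ^ 2 ≤ K₂ ^ 4 := pow_le_pow_right₀ hK₂1 (by norm_num)
      calc (K₂ * r ^ 2) ^ 2 = K₂ ^ 2 * r ^ 4 := by ring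
        _ ≤ K₂ ^ 4 * r ^ 4 := by gcongr
        _ = _ := by ring
    constructor
    · have h4 : |linForm k (reMean a m π i) - m k (π k i)| ^ 4 ≤ (K₂ * r) ^ 4 := by
        rw [Even.pow_abs (by decide : Even 4)]
        have := sq_nonneg (quadForm k (reCov b s π i) - s k (π k i))
        linarith
      exact le_of_pow_le_pow_left₀ (by norm_num) (by positivity) h4
    · refine abs_le_of_sq_le_sq ?_ (by positivity)
      have : 0 ≤ (linForm k (reMean a m π i) - m k (π k i)) ^ 4 := by positivity
      linarith
  -- a majority of the directions relate the two labellings in the same way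
  obtain ⟨ρ, hρ⟩ : ∃ ρ : Equiv.Perm (Fin 2),
      12 < (Finset.univ.filter fun k => (π k)⁻¹ * τ k = ρ).card := by
    refine Fintype.exists_lt_card_fiber_of_mul_lt_card (fun k => (π k)⁻¹ * τ k) ?_
    simp [Fintype.card_perm]
  obtain ⟨hmean, hcov⟩ := hstab _ hρ
  have hlab : ∀ k ∈ Finset.univ.filter (fun k => (π k)⁻¹ * τ k = ρ), ∀ i,
      τ k i = π k (ρ i) := by
    intro k hk i
    rw [← (Finset.mem_filter.1 hk).2]
    simp
  refine ⟨ρ, fun i => ⟨fun j => ?_, fun j l => ?_⟩⟩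
  · have := hmean (μ i - reMean a m π (ρ i)) ((1 + K₂) * r) (fun k hk => ?_) j
    · rw [mul_assoc]
      exact this
    · have h1 := (hτ k i).1
      have h2 := (hbest (ρ i) k).1
      rw [hlab k hk i] at h1
      rw [linForm_sub]
      rw [abs_le] at *
      constructor <;> linarith
  · have := hcov (S i - reCov b s π (ρ i)) ((hS i).sub ?_) ((1 + K₂) * r ^ 2) (fun k hk => ?_) j l
    · rw [mul_assoc]
      exact this
    · exact Matrix.IsSymm.ext fun j l => by simp only [reCov, Matrix.of_apply, hbs j l]
    · have h1 := (hτ k i).2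
      have h2 := (hbest (ρ i) k).2
      rw [hlab k hk i] at h1
      rw [quadForm_sub]
      rw [abs_le] at *
      constructor <;> linarith

/-- The scale estimate is comparable to the variance of the mixture, if the errors are small
compared to the variance. -/
theorem exists_scaleEst_bound (p₀ : ℝ) (hp₀ : 0 < p₀) :
    ∃ κ₁ κ₂ : ℝ, 0 < κ₁ ∧ 0 < κ₂ ∧ ∀ (r : ℝ) (F : Mixture 4) (m s : Fin 25 → Fin 2 → ℝ),
      (∀ i, p₀ ≤ F.weight i) → ApproxProj r F.mean F.cov m s → r ^ 2 ≤ κ₁ * F.variance →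
      κ₁ * F.variance ≤ scaleEst m s ∧ scaleEst m s ≤ κ₂ * F.variance := by
  obtain ⟨K, hK, hstab⟩ := exists_stability_bound
  obtain ⟨L, hL, hlin, hquad⟩ := exists_form_bound
  obtain ⟨hvec, hmat⟩ := hstab Finset.univ (by simp)
  -- errors contribute at most `150 * r ^ 2`, and `F.variance` is at most `3 * K ^ 2` times the sum
  -- of the exact projected quantities, half of which survives the errors: `906 = 2 * 3 * 151`
  set κ₁ : ℝ := 1 / (906 * K ^ 2) with hκ₁
  have hκ₁0 : 0 < κ₁ := by positivity
  refine ⟨κ₁, 50 * L ^ 2 * (1 / p₀ ^ 2 + 2 / p₀) + 250 * κ₁, hκ₁0, by positivity,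
    fun r F m s hw happ hr => ?_⟩
  set Δ := F.mean 0 - F.mean 1 with hΔ
  have hq : ∀ k i, 0 ≤ quadForm k (F.cov i) := fun k i => quadForm_nonneg k (F.cov_posSemidef i)
  set S₀ : ℝ := ∑ k, (linForm k Δ ^ 2 + quadForm k (F.cov 0) + quadForm k (F.cov 1)) with hS₀
  have hterm : ∀ k, (linForm k Δ ^ 2 + quadForm k (F.cov 0) + quadForm k (F.cov 1)) / 2 -
        6 * r ^ 2 ≤ (m k 0 - m k 1) ^ 2 + s k 0 + s k 1 ∧
      (m k 0 - m k 1) ^ 2 + s k 0 + s k 1 ≤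
        2 * (linForm k Δ ^ 2 + quadForm k (F.cov 0) + quadForm k (F.cov 1)) + 10 * r ^ 2 := by
    intro k
    obtain ⟨τ, hτ⟩ := happ k
    have hperm : ∀ τ : Equiv.Perm (Fin 2), (τ 0 = 0 ∧ τ 1 = 1) ∨ (τ 0 = 1 ∧ τ 1 = 0) := by decide
    have h1 : (m k 0 - m k 1) ^ 2 = (m k (τ 0) - m k (τ 1)) ^ 2 := by
      rcases hperm τ with ⟨h, h'⟩ | ⟨h, h'⟩ <;> rw [h, h']
      ring
    have h2 : s k 0 + s k 1 = s k (τ 0) + s k (τ 1) := by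
      rcases hperm τ with ⟨h, h'⟩ | ⟨h, h'⟩ <;> rw [h, h']
      ring
    obtain ⟨h3, h4⟩ := hτ 0
    obtain ⟨h5, h6⟩ := hτ 1
    have h7 := linForm_sub k (F.mean 0) (F.mean 1)
    rw [← hΔ] at h7
    rw [add_assoc, add_assoc, h1, h2]
    have h8 : ((m k (τ 0) - m k (τ 1)) - linForm k Δ) ^ 2 ≤ (2 * r) ^ 2 := by
      rw [abs_le] at h3 h5
      refine sq_le_sq' ?_ ?_ <;> linarith
    have := hq k 0
    have := hq k 1
    rw [abs_le] at h4 h6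
    constructor
    · nlinarith [sq_nonneg (2 * (m k (τ 0) - m k (τ 1)) - linForm k Δ)]
    · nlinarith [sq_nonneg ((m k (τ 0) - m k (τ 1)) - 2 * linForm k Δ)]
  have hlow : S₀ / 2 - 150 * r ^ 2 ≤ scaleEst m s := by
    have := Finset.sum_le_sum fun k (_ : k ∈ Finset.univ) => (hterm k).1
    rw [Finset.sum_sub_distrib, ← Finset.sum_div] at this
    simp only [Finset.sum_const, Finset.card_univ, Fintype.card_fin, nsmul_eq_mul] at this
    push_cast at this
    unfold scaleEst
    linarith
  have hupp : scaleEst m s ≤ 2 * S₀ + 250 * r ^ 2 := by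
    have := Finset.sum_le_sum fun k (_ : k ∈ Finset.univ) => (hterm k).2
    rw [Finset.sum_add_distrib (f := fun k =>
      2 * (linForm k Δ ^ 2 + quadForm k (F.cov 0) + quadForm k (F.cov 1))),
      ← Finset.mul_sum] at this
    simp only [Finset.sum_const, Finset.card_univ, Fintype.card_fin, nsmul_eq_mul] at this
    push_cast at this
    unfold scaleEst
    linarith
  have hle : ∀ k, linForm k Δ ^ 2 + quadForm k (F.cov 0) + quadForm k (F.cov 1) ≤ S₀ := fun k =>
    Finset.single_le_sum
      (f := fun k => linForm k Δ ^ 2 + quadForm k (F.cov 0) + quadForm k (F.cov 1))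
      (fun k _ => by have := hq k 0; have := hq k 1; positivity) (Finset.mem_univ k)
  have hS₀0 : 0 ≤ S₀ := Finset.sum_nonneg fun k _ => by
    have := hq k 0; have := hq k 1; positivity
  have hw0 := F.weight_nonneg 0
  have hw1 := F.weight_nonneg 1
  have hws := F.weight_sum
  have he0 := entryNorm_nonneg (F.cov 0)
  have he1 := entryNorm_nonneg (F.cov 1)
  have hV : F.variance = F.weight 0 * F.weight 1 * ‖Δ‖ ^ 2 + F.weight 0 * entryNorm (F.cov 0) +
    F.weight 1 * entryNorm (F.cov 1) := rfl
  -- the projections determine the parameters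
  have hVS : F.variance ≤ 3 * K ^ 2 * S₀ := by
    have h1 : ‖Δ‖ ≤ K * √S₀ := by
      refine (pi_norm_le_iff_of_nonneg (by positivity)).2 fun j => ?_
      refine hvec Δ _ (fun k _ => ?_) j
      refine Real.abs_le_sqrt ?_
      linarith [hle k, hq k 0, hq k 1]
    have h2 : ‖Δ‖ ^ 2 ≤ K ^ 2 * S₀ := by
      calc ‖Δ‖ ^ 2 ≤ (K * √S₀) ^ 2 := pow_le_pow_left₀ (norm_nonneg _) h1 2
        _ = _ := by rw [mul_pow, Real.sq_sqrt hS₀0]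
    have h3 : ∀ i, entryNorm (F.cov i) ≤ K * S₀ := fun i => by
      refine entryNorm_le (by positivity) (hmat _ ?_ _ fun k _ => ?_)
      · exact (F.cov_posSemidef i).isHermitian
      · rw [abs_of_nonneg (hq k i)]
        have := hle k
        have := hq k 0
        have := hq k 1
        have := sq_nonneg (linForm k Δ)
        fin_cases i
        · show quadForm k (F.cov 0) ≤ S₀
          linarith
        · show quadForm k (F.cov 1) ≤ S₀
          linarith
    have h4 : F.weight 0 * F.weight 1 * ‖Δ‖ ^ 2 ≤ 1 * (K ^ 2 * S₀) := by
      gcongr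
      nlinarith
    have h5 : F.weight 0 * entryNorm (F.cov 0) ≤ 1 * (K * S₀) := by
      gcongr
      · linarith
      · exact h3 0
    have h6 : F.weight 1 * entryNorm (F.cov 1) ≤ 1 * (K * S₀) := by
      gcongr
      · linarith
      · exact h3 1
    have h7 : K * S₀ ≤ K ^ 2 * S₀ := by
      gcongr
      nlinarith
    rw [hV]
    linarith
  -- the parameters bound the projections
  have hSV : S₀ ≤ 25 * L ^ 2 * (1 / p₀ ^ 2 + 2 / p₀) * F.variance := by
    have hD : ‖Δ‖ ^ 2 ≤ 1 / p₀ ^ 2 * F.variance := by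
      rw [one_div_mul_eq_div, le_div_iff₀ (by positivity), mul_comm, hV]
      have : p₀ ^ 2 * ‖Δ‖ ^ 2 ≤ F.weight 0 * F.weight 1 * ‖Δ‖ ^ 2 := by
        rw [sq p₀]
        gcongr
        · exact hw 0
        · exact hw 1
      nlinarith [mul_nonneg hw0 he0, mul_nonneg hw1 he1]
    have hE0 : entryNorm (F.cov 0) ≤ 1 / p₀ * F.variance := by
      rw [one_div_mul_eq_div, le_div_iff₀ hp₀, mul_comm, hV]
      have := mul_le_mul_of_nonneg_right (hw 0) he0
      have : 0 ≤ F.weight 0 * F.weight 1 * ‖Δ‖ ^ 2 := by positivity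
      nlinarith [mul_nonneg hw1 he1]
    have hE1 : entryNorm (F.cov 1) ≤ 1 / p₀ * F.variance := by
      rw [one_div_mul_eq_div, le_div_iff₀ hp₀, mul_comm, hV]
      have := mul_le_mul_of_nonneg_right (hw 1) he1
      have : 0 ≤ F.weight 0 * F.weight 1 * ‖Δ‖ ^ 2 := by positivity
      nlinarith [mul_nonneg hw0 he0]
    calc S₀ ≤ ∑ _k : Fin 25, L ^ 2 * ((1 / p₀ ^ 2 + 2 / p₀) * F.variance) := by
          refine Finset.sum_le_sum fun k _ => ?_
          have h1 : linForm k Δ ^ 2 ≤ L ^ 2 * ‖Δ‖ ^ 2 := by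
            rw [← mul_pow, ← sq_abs]
            exact pow_le_pow_left₀ (abs_nonneg _) (hlin k Δ) 2
          have h2 := (le_abs_self _).trans (hquad k (F.cov 0))
          have h3 := (le_abs_self _).trans (hquad k (F.cov 1))
          have h4 : ‖Δ‖ ^ 2 + entryNorm (F.cov 0) + entryNorm (F.cov 1) ≤
              (1 / p₀ ^ 2 + 2 / p₀) * F.variance := by
            have : 2 / p₀ * F.variance = 1 / p₀ * F.variance + 1 / p₀ * F.variance := by ring
            linarith
          have h5 := mul_le_mul_of_nonneg_left h4 (sq_nonneg L)
          linarith
      _ = _ := by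
          simp only [Finset.sum_const, Finset.card_univ, Fintype.card_fin, nsmul_eq_mul]
          push_cast
          ring
  constructor
  · have h1 : 151 * κ₁ * F.variance ≤ S₀ / 2 := by
      have h2 : 151 * κ₁ * (3 * K ^ 2 * S₀) = S₀ / 2 := by
        rw [hκ₁]
        field_simp
        ring
      rw [← h2]
      gcongr
    linarith
  · linarith

/-! ### The reconstruction program -/

/-- The mixture of the projections of the samples to the direction `dir k`. -/
noncomputable def Mixture.proj (F : Mixture 4) (k : Fin 25) : Mixture 1 where
  weight := F.weight
  weight_nonneg := F.weight_nonneg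
  weight_sum := F.weight_sum
  mean i := fun _ => linForm k (F.mean i)
  cov i := Matrix.of fun _ _ => quadForm k (F.cov i)
  cov_posSemidef i := by
    refine Matrix.PosSemidef.of_dotProduct_mulVec_nonneg ?_ fun x => ?_
    · exact Matrix.IsSymm.ext fun _ _ => rfl
    · have h := mul_nonneg (quadForm_nonneg k (F.cov_posSemidef i)) (sq_nonneg (x 0))
      simp only [dotProduct, Matrix.mulVec, Finset.univ_unique, Fin.default_eq_zero,
        Finset.sum_singleton, Matrix.of_apply, Pi.star_apply, star_trivial, Fin.isValue]
      linarith

theorem entryNorm_one (S : Matrix (Fin 1) (Fin 1) ℝ) : entryNorm S = |S 0 0| := by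
  refine le_antisymm (entryNorm_le (abs_nonneg _) fun i j => ?_) (abs_apply_le_entryNorm S 0 0)
  rw [Subsingleton.elim i 0, Subsingleton.elim j 0]

theorem norm_fin_one (u : Fin 1 → ℝ) : ‖u‖ = |u 0| := by
  refine le_antisymm ((pi_norm_le_iff_of_nonneg (abs_nonneg _)).2 fun i => ?_)
    (norm_le_pi_norm u 0)
  rw [Subsingleton.elim i 0]
  rfl

theorem Mixture.variance_nonneg {d : ℕ} (F : Mixture d) : 0 ≤ F.variance := by
  have h0 := F.weight_nonneg 0
  have h1 := F.weight_nonneg 1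
  have := entryNorm_nonneg (F.cov 0)
  have := entryNorm_nonneg (F.cov 1)
  unfold Mixture.variance
  positivity

theorem Mixture.variance_proj_le {L : ℝ} (hlin : ∀ k u, |linForm k u| ≤ L * ‖u‖)
    (hquad : ∀ k S, |quadForm k S| ≤ L ^ 2 * entryNorm S) (F : Mixture 4) (k : Fin 25) :
    (F.proj k).variance ≤ L ^ 2 * F.variance := by
  have h0 := F.weight_nonneg 0
  have h1 := F.weight_nonneg 1
  have h2 : ‖(F.proj k).mean 0 - (F.proj k).mean 1‖ ^ 2 ≤ L ^ 2 * ‖F.mean 0 - F.mean 1‖ ^ 2 := by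
    rw [norm_fin_one, ← mul_pow]
    refine pow_le_pow_left₀ (abs_nonneg _) ?_ 2
    refine le_trans (le_of_eq ?_) (hlin k (F.mean 0 - F.mean 1))
    rw [linForm_sub]
    rfl
  have h3 : ∀ i, entryNorm ((F.proj k).cov i) ≤ L ^ 2 * entryNorm (F.cov i) := fun i => by
    rw [entryNorm_one]
    exact hquad k (F.cov i)
  calc (F.proj k).variance ≤ F.weight 0 * F.weight 1 * (L ^ 2 * ‖F.mean 0 - F.mean 1‖ ^ 2) +
        F.weight 0 * (L ^ 2 * entryNorm (F.cov 0)) +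
        F.weight 1 * (L ^ 2 * entryNorm (F.cov 1)) :=
        add_le_add (add_le_add (mul_le_mul_of_nonneg_left h2 (mul_nonneg h0 h1))
          (mul_le_mul_of_nonneg_left (h3 0) h0)) (mul_le_mul_of_nonneg_left (h3 1) h1)
    _ = L ^ 2 * F.variance := by
        unfold Mixture.variance
        ring

/-- A component of an encoded mixture. -/
def readComp (y : outTy.Val) (i : Fin 2) : compTy.Val := if i = 0 then y.1 else y.2

/-- The mean of a component of an encoded one-dimensional mixture. -/
def readMean (y : outTy.Val) (i : Fin 2) : ℝ := List.headD (α := ℝ) (readComp y i).2.1 0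

/-- The variance of a component of an encoded one-dimensional mixture. -/
def readVar (y : outTy.Val) (i : Fin 2) : ℝ :=
  List.headD (α := ℝ) (List.headD (α := List ℝ) (readComp y i).2.2 []) 0

/-- The output that stands in for missing outputs. -/
def defaultOut : outTy.Val := (((0 : ℝ), ([] : List ℝ), ([] : List (List ℝ))),
  ((0 : ℝ), ([] : List ℝ), ([] : List (List ℝ))))

theorem readComp_encodeMixture {d : ℕ} (G : Mixture d) (i : Fin 2) :
    readComp (encodeMixture G) i = encodeComponent G i := by
  fin_cases i <;> rfl

theorem readMean_encodeMixture (G : Mixture 1) (i : Fin 2) :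
    readMean (encodeMixture G) i = G.mean i 0 := by
  rw [readMean, readComp_encodeMixture]
  rfl

theorem readVar_encodeMixture (G : Mixture 1) (i : Fin 2) :
    readVar (encodeMixture G) i = G.cov i 0 0 := by
  rw [readVar, readComp_encodeMixture]
  rfl

section

variable {a : Ty}

theorem ConstTime.readComp {f : a.Val → outTy.Val} (hf : ConstTime f) (i : Fin 2) :
    ConstTime (b := compTy) (fun x => GaussMix.readComp (f x) i) := by
  fin_cases i
  · exact ConstTime.fst (b := compTy) (c := compTy) hf
  · exact ConstTime.snd (b := compTy) (c := compTy) hf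

theorem ConstTimeReal.readMean {f : a.Val → outTy.Val} (hf : ConstTime f) (i : Fin 2) :
    ConstTimeReal (fun x => GaussMix.readMean (f x) i) :=
  ConstTime.headD (b := .real)
    (ConstTime.fst (b := vecTy) (c := .list vecTy)
      (ConstTime.snd (b := .real) (c := .prod vecTy (.list vecTy)) (ConstTime.readComp hf i)))
    ConstTimeReal.zero

theorem ConstTimeReal.readVar {f : a.Val → outTy.Val} (hf : ConstTime f) (i : Fin 2) :
    ConstTimeReal (fun x => GaussMix.readVar (f x) i) :=
  ConstTime.headD (b := .real)
    (ConstTime.headD (b := vecTy)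
      (ConstTime.snd (b := vecTy) (c := .list vecTy)
        (ConstTime.snd (b := .real) (c := .prod vecTy (.list vecTy)) (ConstTime.readComp hf i)))
      (ConstTime.nil (b := .real)))
    ConstTimeReal.zero

theorem ConstTime.defaultOut : ConstTime (a := a) (b := outTy) (fun _ => GaussMix.defaultOut) := by
  have h : ConstTime (a := a) (b := compTy)
      (fun _ => ((0 : ℝ), ([] : List ℝ), ([] : List (List ℝ)))) :=
    ConstTime.pair (b := .real) (c := .prod vecTy (.list vecTy)) ConstTimeReal.zero
      (ConstTime.pair (b := vecTy) (c := .list vecTy) (ConstTime.nil (b := .real))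
        (ConstTime.nil (b := vecTy)))
  exact ConstTime.pair (b := compTy) (c := compTy) h h

end

/-- The input of the reconstruction: the original input, which contains `ε`, and the mixtures
learned from the projections. -/
abbrev postTy : Ty := .prod inTy (.list outTy)

/-- The learned means. -/
def dataMean (x : postTy.Val) (k : Fin 25) (i : Fin 2) : ℝ :=
  readMean (List.getD (α := outTy.Val) x.2 k defaultOut) i

/-- The learned variances. -/
def dataVar (x : postTy.Val) (k : Fin 25) (i : Fin 2) : ℝ :=
  readVar (List.getD (α := outTy.Val) x.2 k defaultOut) i

theorem constTime_entry (k : Fin 25) : ConstTime (a := postTy) (b := outTy)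
    (fun x => List.getD (α := outTy.Val) x.2 k defaultOut) :=
  ConstTime.getD (b := outTy) (ConstTime.snd (b := inTy) (c := .list outTy) ConstTime.id)
    ConstTime.defaultOut _

theorem constTimeReal_dataMean (k : Fin 25) (i : Fin 2) :
    ConstTimeReal (a := postTy) (fun x => dataMean x k i) :=
  ConstTimeReal.readMean (constTime_entry k) i

theorem constTimeReal_dataVar (k : Fin 25) (i : Fin 2) :
    ConstTimeReal (a := postTy) (fun x => dataVar x k i) :=
  ConstTimeReal.readVar (constTime_entry k) i

/-- The accuracy requested in the input. -/
def dataEps (x : postTy.Val) : ℝ := x.1.1.1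

theorem constTimeReal_dataEps : ConstTimeReal (a := postTy) dataEps :=
  ConstTime.fst (b := .real) (c := .real) (ConstTime.fst (b := .prod .real .real) (c := .list vecTy)
    (ConstTime.fst (b := inTy) (c := .list outTy) ConstTime.id))

section

variable (a : Fin 4 → Fin 25 → ℚ) (b : Fin 4 → Fin 4 → Fin 25 → ℚ) (θ : ℚ)
  (π : Fin 25 → Equiv.Perm (Fin 2))

/-- The reconstructed covariance matrix, made positive semidefinite by a multiple of the
identity. -/
noncomputable def postCov (x : postTy.Val) (i : Fin 2) : Matrix (Fin 4) (Fin 4) ℝ :=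
  reCov b (dataVar x) π i +
    ((θ : ℝ) * dataEps x ^ 2 * scaleEst (dataMean x) (dataVar x)) • (1 : Matrix (Fin 4) (Fin 4) ℝ)

/-- The encoding of a reconstructed component. The weights play no role. -/
noncomputable def postComp (x : postTy.Val) (i : Fin 2) : compTy.Val :=
  ((1 / 2 : ℝ), encodeVec (reMean a (dataMean x) π i),
    (List.ofFn fun j => encodeVec (postCov b θ π x i j) : List vecTy.Val))

theorem constTimeReal_reMean (i : Fin 2) (j : Fin 4) :
    ConstTimeReal (a := postTy) (fun x => reMean a (dataMean x) π i j) :=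
  ConstTimeReal.sum _ fun k => (ConstTimeReal.const _).mul (constTimeReal_dataMean k _)

theorem constTimeReal_reCov (i : Fin 2) (j l : Fin 4) :
    ConstTimeReal (a := postTy) (fun x => reCov b (dataVar x) π i j l) :=
  ConstTimeReal.sum Finset.univ fun k =>
    (ConstTimeReal.const (b j l k)).mul (constTimeReal_dataVar k (π k i))

theorem constTimeReal_scaleEst :
    ConstTimeReal (a := postTy) (fun x => scaleEst (dataMean x) (dataVar x)) :=
  ConstTimeReal.sum _ fun k =>
    ((((constTimeReal_dataMean k 0).sub (constTimeReal_dataMean k 1)).pow 2).add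
      (constTimeReal_dataVar k 0)).add (constTimeReal_dataVar k 1)

theorem constTimeReal_postCov (i : Fin 2) (j l : Fin 4) :
    ConstTimeReal (a := postTy) (fun x => postCov b θ π x i j l) := by
  refine ((constTimeReal_reCov b π i j l).add
    ((((ConstTimeReal.const θ).mul (constTimeReal_dataEps.pow 2)).mul
      constTimeReal_scaleEst).mul (ConstTimeReal.const (if j = l then 1 else 0)))).of_eq
    fun x => ?_
  simp only [postCov, Matrix.add_apply, Matrix.smul_apply, Matrix.one_apply, smul_eq_mul]
  split_ifs
  · rw [Rat.cast_one]
  · rw [Rat.cast_zero]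

theorem constTimeReal_residual :
    ConstTimeReal (a := postTy) (fun x => residual a b (dataMean x) (dataVar x) π) := by
  refine ConstTimeReal.sum _ fun i => ConstTimeReal.sum _ fun k => ?_
  refine ConstTimeReal.add (ConstTimeReal.pow (ConstTimeReal.sub ?_
    (constTimeReal_dataMean k _)) 4) (ConstTimeReal.pow (ConstTimeReal.sub ?_
    (constTimeReal_dataVar k _)) 2)
  · exact ConstTimeReal.sum _ fun j => (ConstTimeReal.const _).mul (constTimeReal_reMean a π i j)
  · exact ConstTimeReal.sum _ fun j => ConstTimeReal.sum _ fun l =>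
      ((ConstTimeReal.const _).mul (ConstTimeReal.const _)).mul (constTimeReal_reCov b π i j l)

theorem constTime_postComp (i : Fin 2) :
    ConstTime (a := postTy) (b := compTy) (fun x => postComp a b θ π x i) := by
  refine ConstTime.pair (b := .real) (c := .prod vecTy (.list vecTy))
    (ConstTimeReal.of_eq (ConstTimeReal.const (1 / 2)) fun _ => by push_cast; rfl) ?_
  exact ConstTime.pair (b := vecTy) (c := .list vecTy)
    (ConstTime.ofFn (b := .real) fun j => constTimeReal_reMean a π i j)
    (ConstTime.ofFn (b := vecTy) fun j =>
      ConstTime.ofFn (b := .real) fun l => constTimeReal_postCov b θ π i j l)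

end

theorem getD_ofFn {α : Type*} {n : ℕ} (f : Fin n → α) (d : α) (k : Fin n) :
    (List.ofFn f).getD k d = f k := by
  simp [List.getD_eq_getElem?_getD]

/-- A constant-time program reconstructs a mixture in `ℝ⁴` from sufficiently precise approximations
of its projections. -/
theorem exists_constTime_reconstruct (p₀ : ℝ) (hp₀ : 0 < p₀) :
    ∃ c₀ : ℝ, 0 < c₀ ∧ ∃ post : postTy.Val → outTy.Val, ConstTime post ∧
      ∀ c : ℝ, 0 < c → c ≤ c₀ → ∀ ε : ℝ, 0 < ε → ε ≤ 1 →
        ∀ (δ : ℝ) (xs : List vecTy.Val) (F : Mixture 4),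
        (∀ i, p₀ ≤ F.weight i) → ∀ G : Fin 25 → Mixture 1,
        (∀ k, (G k).IsClose (c * ε) (F.proj k)) →
        ∃ H : Mixture 4, post (((ε, δ), xs), (List.ofFn fun k => encodeMixture (G k) :
          List outTy.Val)) = encodeMixture H ∧ H.IsClose ε F := by
  obtain ⟨a, ha⟩ := exists_rat_eq_sum_linForm Finset.univ (by simp)
  obtain ⟨b, hbs, hb⟩ := exists_rat_eq_sum_quadForm Finset.univ (by simp)
  obtain ⟨K, hK, hrec⟩ := exists_reconstruction_bound ha hbs hb
  obtain ⟨κ₁, κ₂, hκ₁, hκ₂, hscale⟩ := exists_scaleEst_bound p₀ hp₀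
  obtain ⟨L, hL, hlin, hquad⟩ := exists_form_bound
  obtain ⟨θ, hθ0, hθ⟩ := exists_rat_btwn (show (0 : ℝ) < 1 / (2 * κ₂) by positivity)
  have hθκ : (θ : ℝ) * κ₂ ≤ 1 / 2 := by
    rw [lt_div_iff₀ (by positivity)] at hθ
    linarith
  obtain ⟨post, hpost, hargmin⟩ := exists_constTime_argmin
    (a := postTy) (b := outTy) (ι := Fin 25 → Equiv.Perm (Fin 2))
    (R := fun π x => residual a b (dataMean x) (dataVar x) π)
    (g := fun π x => (postComp a b θ π x 0, postComp a b θ π x 1))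
    (constTimeReal_residual a b)
    (fun π => ConstTime.pair (b := compTy) (c := compTy) (constTime_postComp a b θ π 0)
      (constTime_postComp a b θ π 1))
  set q : ℝ := min κ₁ (min (1 / 2) (θ * κ₁ / 4)) with hq
  have hq0 : 0 < q := lt_min hκ₁ (lt_min (by norm_num) (by positivity))
  refine ⟨min 1 (q / (K ^ 2 * L ^ 2)), lt_min one_pos (by positivity), post, hpost,
    fun c hc0 hc ε hε hε1 δ xs F hw G hG => ?_⟩
  have hcK : K ^ 2 * (c ^ 2 * L ^ 2) ≤ q := by
    have h1 : c ≤ q / (K ^ 2 * L ^ 2) := hc.trans (min_le_right _ _)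
    rw [le_div_iff₀ (by positivity)] at h1
    have h2 : c ^ 2 ≤ c := by nlinarith [hc.trans (min_le_left _ _)]
    have h3 := mul_le_mul_of_nonneg_right h2 (show 0 ≤ K ^ 2 * L ^ 2 by positivity)
    linarith
  have hcK1 : K * (c ^ 2 * L ^ 2) ≤ q := by
    refine le_trans ?_ hcK
    have : K ≤ K ^ 2 := by nlinarith
    gcongr
  have hcK2 : c ^ 2 * L ^ 2 ≤ q := by
    refine le_trans ?_ hcK1
    exact le_mul_of_one_le_left (by positivity) hK
  have hq1 : q ≤ κ₁ := min_le_left _ _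
  have hq2 : q ≤ 1 / 2 := (min_le_right _ _).trans (min_le_left _ _)
  have hq3 : q ≤ θ * κ₁ / 4 := (min_le_right _ _).trans (min_le_right _ _)
  set x : postTy.Val :=
    (((ε, δ), xs), (List.ofFn fun k => encodeMixture (G k) : List outTy.Val)) with hx
  have hV := F.variance_nonneg
  set V := F.variance with hVdef
  set r : ℝ := c * ε * L * √V with hr
  have hr0 : 0 ≤ r := by positivity
  have hr2 : r ^ 2 = c ^ 2 * L ^ 2 * (ε ^ 2 * V) := by
    rw [hr, mul_pow, Real.sq_sqrt hV]
    ring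
  have hεV : 0 ≤ ε ^ 2 * V := by positivity
  have hentry : ∀ k : Fin 25,
      List.getD (α := outTy.Val) x.2 k defaultOut = encodeMixture (G k) :=
    fun k => getD_ofFn (fun k => encodeMixture (G k)) defaultOut k
  have happ : ApproxProj r F.mean F.cov (dataMean x) (dataVar x) := by
    intro k
    obtain ⟨τ, hτ⟩ := hG k
    refine ⟨τ, fun i => ?_⟩
    have h1 : (c * ε) ^ 2 * (F.proj k).variance ≤ r ^ 2 := by
      have := mul_le_mul_of_nonneg_left (F.variance_proj_le hlin hquad k) (sq_nonneg (c * ε))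
      rw [hr2]
      linarith
    have h2 := (hτ i).trans h1
    rw [max_le_iff, norm_fin_one, entryNorm_one] at h2
    simp only [dataMean, dataVar, hentry, readMean_encodeMixture, readVar_encodeMixture]
    exact ⟨le_of_pow_le_pow_left₀ two_ne_zero hr0 h2.1, h2.2⟩
  obtain ⟨π, hπ, hmin⟩ := hargmin x
  obtain ⟨ρ, hρ⟩ := hrec r F.mean F.cov (dataMean x) (dataVar x) π hr0
    (fun i => (F.cov_posSemidef i).isHermitian) happ hmin
  obtain ⟨hs1, hs2⟩ := hscale r F (dataMean x) (dataVar x) hw happ (by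
    rw [hr2]
    have h1 : ε ^ 2 * V ≤ V := mul_le_of_le_one_left hV (pow_le_one₀ hε.le hε1)
    have h2 : c ^ 2 * L ^ 2 ≤ κ₁ := hcK2.trans hq1
    gcongr)
  set sh : ℝ := (θ : ℝ) * dataEps x ^ 2 * scaleEst (dataMean x) (dataVar x) with hsh
  have hdε : dataEps x = ε := rfl
  rw [hdε] at hsh
  have hsh0 : 4 * (K * r ^ 2) ≤ sh := by
    calc 4 * (K * r ^ 2) = 4 * (K * (c ^ 2 * L ^ 2)) * (ε ^ 2 * V) := by rw [hr2]; ring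
      _ ≤ 4 * (θ * κ₁ / 4) * (ε ^ 2 * V) := by
          have := hcK1.trans hq3
          gcongr
      _ = θ * ε ^ 2 * (κ₁ * V) := by ring
      _ ≤ sh := by rw [hsh]; gcongr
  have hsh1 : sh ≤ 1 / 2 * (ε ^ 2 * V) := by
    calc sh ≤ θ * ε ^ 2 * (κ₂ * V) := by rw [hsh]; gcongr
      _ = θ * κ₂ * (ε ^ 2 * V) := by ring
      _ ≤ _ := by gcongr
  have hsh00 : 0 ≤ sh := le_trans (by positivity) hsh0
  refine ⟨⟨fun _ => 1 / 2, fun _ => by norm_num, by norm_num, reMean a (dataMean x) π,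
    postCov b θ π x, fun i => ?_⟩, hπ, ρ, fun i => max_le ?_ ?_⟩
  · refine posSemidef_of_near (F.cov_posSemidef (ρ⁻¹ i))
      (Matrix.IsSymm.ext fun j l => by simp only [reCov, Matrix.of_apply, hbs j l])
      (fun j l => ?_) hsh0
    rw [abs_sub_comm]
    simpa using (hρ (ρ⁻¹ i)).2 j l
  · have h1 : ‖F.mean i - reMean a (dataMean x) π (ρ i)‖ ≤ K * r :=
      (pi_norm_le_iff_of_nonneg (by positivity)).2 fun j => (hρ i).1 j
    calc ‖F.mean i - reMean a (dataMean x) π (ρ i)‖ ^ 2 ≤ (K * r) ^ 2 :=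
          pow_le_pow_left₀ (norm_nonneg _) h1 2
      _ = K ^ 2 * (c ^ 2 * L ^ 2) * (ε ^ 2 * V) := by rw [mul_pow, hr2]; ring
      _ ≤ 1 * (ε ^ 2 * V) := by
          have : K ^ 2 * (c ^ 2 * L ^ 2) ≤ 1 := by linarith
          gcongr
      _ = _ := one_mul _
  · refine entryNorm_le hεV fun j l => ?_
    have h1 := (hρ i).2 j l
    have h2 : K * r ^ 2 ≤ 1 / 2 * (ε ^ 2 * V) := by
      calc K * r ^ 2 = K * (c ^ 2 * L ^ 2) * (ε ^ 2 * V) := by rw [hr2]; ring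
        _ ≤ _ := by
          have := hcK1.trans hq2
          gcongr
    have h3 : (F.cov i - postCov b θ π x (ρ i)) j l =
        (F.cov i j l - reCov b (dataVar x) π (ρ i) j l) - if j = l then sh else 0 := by
      simp only [postCov, Matrix.sub_apply, Matrix.add_apply, Matrix.smul_apply,
        Matrix.one_apply, smul_eq_mul, ← hsh, hdε]
      split_ifs <;> ring
    show |(F.cov i - postCov b θ π x (ρ i)) j l| ≤ _
    rw [h3]
    rw [abs_le] at h1 ⊢
    split_ifs <;> constructor <;> linarith

/-! ### Projecting the samples -/

/-- The projection of `ℝ⁴` to the direction `dir k`. -/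
noncomputable def projVec (k : Fin 25) (x : EuclideanSpace ℝ (Fin 4)) :
    EuclideanSpace ℝ (Fin 1) :=
  WithLp.toLp 2 fun _ => linForm k fun j => x j

theorem measurable_projVec (k : Fin 25) : Measurable (projVec k) := by
  unfold projVec linForm
  fun_prop

theorem map_projVec_multivariateGaussian (k : Fin 25) (u : Fin 4 → ℝ)
    {S : Matrix (Fin 4) (Fin 4) ℝ} (hS : S.PosSemidef)
    (hS' : (Matrix.of fun _ _ : Fin 1 => quadForm k S).PosSemidef) :
    (multivariateGaussian (WithLp.toLp 2 u) S).map (projVec k) =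
      multivariateGaussian (WithLp.toLp 2 fun _ => linForm k u)
        (Matrix.of fun _ _ => quadForm k S) := by
  have : IsProbabilityMeasure ((multivariateGaussian (WithLp.toLp 2 u) S).map (projVec k)) :=
    Measure.isProbabilityMeasure_map (measurable_projVec k).aemeasurable
  refine Measure.ext_of_charFun (funext fun t => ?_)
  set w : EuclideanSpace ℝ (Fin 4) := WithLp.toLp 2 fun j => t 0 * (dir k j : ℝ) with hw
  have h1 : ∀ x, inner ℝ (projVec k x) t = inner ℝ x w := fun x => by
    simp only [projVec, linForm, hw, PiLp.inner_apply, Finset.univ_unique, Fin.default_eq_zero,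
      Finset.sum_singleton, RCLike.inner_apply, conj_trivial, Finset.mul_sum]
    exact Finset.sum_congr rfl fun j _ => by ring
  have h2 : charFun ((multivariateGaussian (WithLp.toLp 2 u) S).map (projVec k)) t =
      charFun (multivariateGaussian (WithLp.toLp 2 u) S) w := by
    rw [charFun_apply, integral_map (measurable_projVec k).aemeasurable (by fun_prop),
      charFun_apply]
    simp only [h1]
  rw [h2, charFun_multivariateGaussian hS, charFun_multivariateGaussian hS']
  congr 2
  · congr 2
    rw [real_inner_comm, ← h1, real_inner_comm]
    rfl
  · congr 2
    simp only [hw, quadForm, dotProduct, Matrix.mulVec, Fin.sum_univ_four, Finset.univ_unique,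
      Fin.default_eq_zero, Finset.sum_singleton, Matrix.of_apply]
    ring

instance isProbabilityMeasure_law {d : ℕ} (F : Mixture d) : IsProbabilityMeasure F.law := by
  constructor
  rw [Mixture.law, Measure.add_apply, Measure.smul_apply, Measure.smul_apply]
  simp only [measure_univ, smul_eq_mul, mul_one]
  rw [← ENNReal.ofReal_add (F.weight_nonneg 0) (F.weight_nonneg 1), F.weight_sum,
    ENNReal.ofReal_one]

theorem map_projVec_law (F : Mixture 4) (k : Fin 25) :
    F.law.map (projVec k) = (F.proj k).law := by
  rw [Mixture.law, Measure.map_add _ _ (measurable_projVec k), Measure.map_smul,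
    Measure.map_smul,
    map_projVec_multivariateGaussian k _ (F.cov_posSemidef 0) ((F.proj k).cov_posSemidef 0),
    map_projVec_multivariateGaussian k _ (F.cov_posSemidef 1) ((F.proj k).cov_posSemidef 1)]
  rfl

/-! ### Randomness of sub-computations -/

instance isProbabilityMeasure_tapeLaw : IsProbabilityMeasure tapeLaw := by
  unfold tapeLaw
  infer_instance

/-- A sub-computation has independent uniform random numbers, too. -/
theorem measurePreserving_sub (k : ℕ) :
    MeasurePreserving (fun ω : Tape => ω.sub k) tapeLaw tapeLaw := by
  have hm : Measurable (fun ω : Tape => ω.sub k) :=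
    measurable_pi_lambda _ fun l => measurable_pi_apply (k :: l)
  refine ⟨hm, Measure.eq_infinitePi _ fun s t ht => ?_⟩
  classical
  have hinj : Function.Injective (List.cons k) := fun _ _ h => (List.cons.inj h).2
  have hpre : (fun ω : Tape => ω.sub k) ⁻¹' Set.pi s t =
      Set.pi (s.map ⟨_, hinj⟩) fun l => t l.tail := by
    ext ω
    simp [Tape.sub, Set.mem_pi]
  rw [Measure.map_apply hm (MeasurableSet.pi s.countable_toSet fun i _ => ht i), hpre, tapeLaw,
    Measure.infinitePi_pi _ fun l _ => ht l.tail, Finset.prod_map]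
  rfl

/-- The joint law of the samples and the random numbers. -/
noncomputable def runLaw {d : ℕ} (F : Mixture d) (n : ℕ) :
    Measure ((Fin n → EuclideanSpace ℝ (Fin d)) × Tape) :=
  (Measure.pi fun _ : Fin n => F.law).prod tapeLaw

theorem measurePreserving_runLaw_sub {d : ℕ} (F : Mixture d) (n k : ℕ) :
    MeasurePreserving (Prod.map id fun ω : Tape => ω.sub k) (runLaw F n) (runLaw F n) :=
  (MeasurePreserving.id _).prod (measurePreserving_sub k)

theorem measurePreserving_runLaw_proj (F : Mixture 4) (n : ℕ) (k : Fin 25) :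
    MeasurePreserving (Prod.map (fun x j => projVec k (x j)) id) (runLaw F n)
      (runLaw (F.proj k) n) := by
  refine MeasurePreserving.prod ?_ (MeasurePreserving.id _)
  exact measurePreserving_pi (fun _ : Fin n => F.law) (fun _ : Fin n => (F.proj k).law)
    fun _ => ⟨measurable_projVec k, map_projVec_law F k⟩

/-- No measurability of `s` is needed for this inequality. -/
theorem measure_preimage_le_of_measurePreserving {α β : Type*} [MeasurableSpace α]
    [MeasurableSpace β] {μ : Measure α} {ν : Measure β} {g : α → β} (hg : MeasurePreserving g μ ν)
    (s : Set β) : μ (g ⁻¹' s) ≤ ν s :=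
  (Measure.le_map_apply hg.aemeasurable s).trans_eq (by rw [hg.map_eq])

/-! ### Running the one-dimensional learner on all projections -/

/-- The accuracy `ε` in the input of a learner. -/
def inEps (x : inTy.Val) : ℝ := x.1.1

/-- The error probability `δ` in the input of a learner. -/
def inDelta (x : inTy.Val) : ℝ := x.1.2

theorem constTimeReal_inEps : ConstTimeReal (a := inTy) inEps :=
  ConstTime.fst (b := .real) (c := .real)
    (ConstTime.fst (b := .prod .real .real) (c := .list vecTy) ConstTime.id)

theorem constTimeReal_inDelta : ConstTimeReal (a := inTy) inDelta :=
  ConstTime.snd (b := .real) (c := .real)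
    (ConstTime.fst (b := .prod .real .real) (c := .list vecTy) ConstTime.id)

/-- The accuracy and the error probability passed to the one-dimensional learner, and the projected
samples. -/
noncomputable def projInput (c : ℚ) (k : Fin 25) (x : inTy.Val) : inTy.Val :=
  (((c : ℝ) * inEps x, (c : ℝ) * inDelta x / Real.log (1 / (inEps x * inDelta x))),
    (List.map (fun l : List ℝ => [∑ j : Fin 4, (dir k j : ℝ) * l.getD j 0]) x.2 :
      List (List ℝ)))

theorem projInput_encodeInput (c : ℚ) (k : Fin 25) (ε δ : ℝ) {n : ℕ}
    (x : Fin n → EuclideanSpace ℝ (Fin 4)) :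
    projInput c k (encodeInput ε δ x) = encodeInput (c * ε)
      (c * δ / Real.log (1 / (ε * δ))) fun j => projVec k (x j) := by
  have h : ∀ j, [∑ i : Fin 4, (dir k i : ℝ) *
      (List.ofFn fun i => x j i : List ℝ).getD i 0] = [linForm k fun i => x j i] := fun j => by
    simp only [getD_ofFn]
    rfl
  refine Prod.ext rfl ?_
  refine (List.map_ofFn (f := fun j => (List.ofFn fun i => x j i : List ℝ))
    (g := fun l : List ℝ => [∑ j : Fin 4, (dir k j : ℝ) * l.getD j 0])).trans ?_
  exact congrArg List.ofFn (funext h)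

theorem exists_prog_projInput (c : ℚ) (k : Fin 25) :
    ∃ (p : Prog inTy inTy) (T : ℕ), ∀ ω (x : inTy.Val),
      ∃ t ≤ T * (List.length x.2 + 1), p.Runs ω x (projInput c k x) t := by
  have hparam : ConstTime (a := inTy) (b := .prod .real .real) (fun x =>
      ((c : ℝ) * inEps x,
        (c : ℝ) * inDelta x / Real.log (((1 : ℚ) : ℝ) / (inEps x * inDelta x)))) :=
    ConstTime.pair (b := .real) (c := .real) ((ConstTimeReal.const c).mul constTimeReal_inEps)
      (((ConstTimeReal.const c).mul constTimeReal_inDelta).div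
        (((ConstTimeReal.const 1).div (constTimeReal_inEps.mul constTimeReal_inDelta)).log))
  have hvec : ConstTime (a := vecTy) (b := vecTy)
      (fun l : List ℝ => ([∑ j : Fin 4, (dir k j : ℝ) * l.getD j 0] : List ℝ)) :=
    ConstTime.cons (b := .real) (ConstTimeReal.sum _ fun j => (ConstTimeReal.const _).mul
      (ConstTime.getD (b := .real) ConstTime.id ConstTimeReal.zero j)) ConstTime.nil
  obtain ⟨p, T, hp⟩ := hparam
  obtain ⟨q, T', hq⟩ := exists_prog_map hvec
  refine ⟨.pair p (.comp (.snd (.prod .real .real) (.list vecTy)) q), T + T' + 3, fun ω x => ?_⟩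
  obtain ⟨s, hs, hs'⟩ := hp (ω.sub 0) x
  obtain ⟨u, hu, hu'⟩ := hq ((ω.sub 1).sub 1) x.2
  rw [Rat.cast_one] at hs'
  refine ⟨s + (1 + u + 1) + 1, ?_, s, _, hs', ⟨x.2, 1, u, ⟨rfl, rfl⟩, hu', rfl⟩, rfl⟩
  nlinarith

/-- The program that runs `A` on several preprocessed inputs and lists the results. -/
def callAll (A : Prog inTy outTy) (P : Fin 25 → Prog inTy inTy) :
    List (Fin 25) → Prog inTy (.list outTy)
  | [] => .nil _ _
  | k :: ks => .comp (.pair (.comp (P k) A) (callAll A P ks)) (.cons outTy)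

theorem callAll_halts {A : Prog inTy outTy} {P : Fin 25 → Prog inTy inTy} {x : inTy.Val} {T : ℕ}
    (h : ∀ k ω, ∃ y, ∃ t ≤ T, (Prog.comp (P k) A).Runs ω x y t) (ks : List (Fin 25)) :
    ∀ ω, ∃ y, ∃ t ≤ (T + 3) * ks.length + 1, (callAll A P ks).Runs ω x y t := by
  induction ks with
  | nil => exact fun ω => ⟨([] : List outTy.Val), 1, by simp, rfl, rfl⟩
  | cons k ks ih =>
    intro ω
    obtain ⟨y, t, ht, hy⟩ := h k ((ω.sub 0).sub 0)
    obtain ⟨ys, t', ht', hys⟩ := ih ((ω.sub 0).sub 1)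
    refine ⟨(List.cons y ys : List outTy.Val), t + t' + 1 + 1 + 1, ?_, (y, ys), _, 1,
      ⟨t, t', hy, hys, rfl⟩, ⟨rfl, rfl⟩, rfl⟩
    rw [List.length_cons]
    nlinarith

/-- Union bound over the runs of the learner. -/
theorem callAll_measure_le {p₀ : ℝ} {A : Prog inTy outTy} {f : ℝ → ℝ → ℕ} (hA : Learns 1 p₀ A f)
    {c : ℚ} {P : Fin 25 → Prog inTy inTy}
    (hP : ∀ k ω x, ∃ t, (P k).Runs ω x (projInput c k x) t) {ε δ : ℝ}
    (hε : (c : ℝ) * ε ∈ Set.Ioo (0 : ℝ) 1)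
    (hδ : (c : ℝ) * δ / Real.log (1 / (ε * δ)) ∈ Set.Ioc (0 : ℝ) (1 / 2))
    {F : Mixture 4} (hF : ∀ i, p₀ ≤ F.weight i) {ks : List (Fin 25)} (hks : ks.Nodup) :
    runLaw F (f (c * ε) (c * δ / Real.log (1 / (ε * δ))))
      {z | ¬ ∃ (G : Fin 25 → Mixture 1) (t : ℕ),
        (callAll A P ks).Runs z.2 (encodeInput ε δ z.1)
          (ks.map fun k => encodeMixture (G k) : List outTy.Val) t ∧
        ∀ k ∈ ks, (G k).IsClose (c * ε) (F.proj k)}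
      ≤ ks.length * ENNReal.ofReal (c * δ / Real.log (1 / (ε * δ))) := by
  set ε' : ℝ := c * ε with hε'
  set δ' : ℝ := c * δ / Real.log (1 / (ε * δ)) with hδ'
  set n := f ε' δ' with hn
  induction ks with
  | nil =>
    refine le_of_eq ?_
    rw [List.length_nil, Nat.cast_zero, zero_mul]
    convert measure_empty (μ := runLaw F n)
    ext z
    simp only [Set.mem_ofPred_eq, Set.mem_empty_iff_false, iff_false, not_not]
    exact ⟨fun k => F.proj k, 1, ⟨rfl, rfl⟩, by simp⟩
  | cons k ks ih =>
    obtain ⟨hk, hks⟩ := List.nodup_cons.1 hks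
    specialize ih hks
    have hone := hA ε' hε δ' hδ (F.proj k) hF
    set S₁ := {z : (Fin n → EuclideanSpace ℝ (Fin 1)) × Tape | ¬ ∃ (G : Mixture 1) (t : ℕ),
      A.Runs z.2 (encodeInput ε' δ' z.1) (encodeMixture G) t ∧ G.IsClose ε' (F.proj k)} with hS₁
    set S₂ := {z : (Fin n → EuclideanSpace ℝ (Fin 4)) × Tape |
      ¬ ∃ (G : Fin 25 → Mixture 1) (t : ℕ), (callAll A P ks).Runs z.2 (encodeInput ε δ z.1)
          (ks.map fun k => encodeMixture (G k) : List outTy.Val) t ∧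
        ∀ k ∈ ks, (G k).IsClose ε' (F.proj k)} with hS₂
    have hsub := fun j => measurePreserving_runLaw_sub F n j
    have h₁ := measure_preimage_le_of_measurePreserving
      ((measurePreserving_runLaw_proj F n k).comp ((hsub 1).comp ((hsub 0).comp (hsub 0)))) S₁
    have h₂ := measure_preimage_le_of_measurePreserving ((hsub 1).comp (hsub 0)) S₂
    rw [List.length_cons, Nat.cast_succ, add_mul, one_mul, add_comm]
    refine le_trans ?_ (add_le_add (h₁.trans hone) (h₂.trans ih))
    refine le_trans (measure_mono fun z hz => ?_) (measure_union_le _ _)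
    by_contra hcon
    simp only [Set.mem_union, not_or, hS₁, hS₂, Set.mem_preimage, Set.mem_ofPred_eq, not_not,
      Function.comp_apply, Prod.map_fst, Prod.map_snd, id] at hcon
    obtain ⟨⟨g, t, hg, hg'⟩, G, u, hG, hG'⟩ := hcon
    refine hz ⟨Function.update G k g, ?_⟩
    have hmap : (k :: ks).map (fun j => encodeMixture (Function.update G k g j)) =
        encodeMixture g :: ks.map fun j => encodeMixture (G j) := by
      rw [List.map_cons, Function.update_self]
      congr 1
      refine List.map_congr_left fun j hj => ?_
      rw [Function.update_of_ne (ne_of_mem_of_not_mem hj hk)]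
    obtain ⟨s, hs⟩ := hP k (((z.2.sub 0).sub 0).sub 0) (encodeInput ε δ z.1)
    rw [projInput_encodeInput] at hs
    refine ⟨s + t + 1 + u + 1 + 1 + 1, ?_, fun j hj => ?_⟩
    · refine ⟨(encodeMixture g, (ks.map fun j => encodeMixture (G j) : List outTy.Val)), _, 1,
        ⟨s + t + 1, u, ⟨_, s, t, hs, hg, rfl⟩, hG, rfl⟩, ⟨hmap, rfl⟩, rfl⟩
    · rcases List.mem_cons.1 hj with rfl | hj
      · rwa [Function.update_self]
      · rw [Function.update_of_ne (ne_of_mem_of_not_mem hj hk)]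
        exact hG' j hj

/-! ### The reduction -/

theorem log_one_div_mul_pos {ε δ : ℝ} (hε : ε ∈ Set.Ioo (0 : ℝ) 1)
    (hδ : δ ∈ Set.Ioc (0 : ℝ) (1 / 2)) : 1 / 2 < Real.log (1 / (ε * δ)) := by
  have h : (2 : ℝ) ≤ 1 / (ε * δ) := by
    rw [le_div_iff₀ (mul_pos hε.1 hδ.1)]
    nlinarith [hε.1, hε.2, hδ.1, hδ.2]
  have h2 := Real.log_le_log two_pos h
  linarith [Real.log_two_gt_d9]

/-- The parameters of the calls are admissible, and 25 calls fail with probability at most `δ`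
altogether. -/
theorem projected_params_mem {c : ℝ} (hc : 0 < c) (hc' : c ≤ 1 / 50) {ε δ : ℝ}
    (hε : ε ∈ Set.Ioo (0 : ℝ) 1) (hδ : δ ∈ Set.Ioc (0 : ℝ) (1 / 2)) :
    c * ε ∈ Set.Ioo (0 : ℝ) 1 ∧
      c * δ / Real.log (1 / (ε * δ)) ∈ Set.Ioc (0 : ℝ) (1 / 2) ∧
      25 * (c * δ / Real.log (1 / (ε * δ))) ≤ δ := by
  have hlog := log_one_div_mul_pos hε hδ
  have hlog0 : 0 < Real.log (1 / (ε * δ)) := by linarith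
  obtain ⟨hε0, hε1⟩ := hε
  obtain ⟨hδ0, hδ1⟩ := hδ
  have h : 25 * (c * δ / Real.log (1 / (ε * δ))) ≤ δ := by
    rw [← mul_div_assoc, div_le_iff₀ hlog0]
    nlinarith [mul_pos hδ0 hc]
  have hpos : 0 < c * δ / Real.log (1 / (ε * δ)) := by positivity
  exact ⟨⟨by positivity, by nlinarith⟩, ⟨hpos, by linarith⟩, h⟩

/-- The running time parameter of the calls is bounded linearly in that of the input. -/
theorem projected_size_le {c : ℝ} (hc : 0 < c) {ε δ : ℝ} (hε : ε ∈ Set.Ioo (0 : ℝ) 1)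
    (hδ : δ ∈ Set.Ioc (0 : ℝ) (1 / 2)) (n : ℕ) :
    n + 1 / (c * ε) + Real.log (1 / (c * δ / Real.log (1 / (ε * δ)))) + 1 ≤
      (3 + 2 / c) * (n + 1 / ε + Real.log (1 / δ) + 1) := by
  have hlog := log_one_div_mul_pos hε hδ
  set y := Real.log (1 / (ε * δ)) with hy
  have hε0 := hε.1
  have hδ0 := hδ.1
  have hy0 : 0 < y := by linarith
  have h1 : y = Real.log (1 / ε) + Real.log (1 / δ) := by
    rw [hy, ← Real.log_mul (by positivity) (by positivity), one_div_mul_one_div]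
  have h2 : Real.log (1 / ε) ≤ 1 / ε := (Real.log_le_sub_one_of_pos (by positivity)).trans
    (by linarith)
  have h3 : Real.log (1 / (c * δ / y)) = Real.log y + Real.log (1 / c) + Real.log (1 / δ) := by
    rw [← Real.log_mul (by positivity) (by positivity),
      ← Real.log_mul (by positivity) (by positivity)]
    congr 1
    field_simp
  have h4 : Real.log y ≤ y := (Real.log_le_sub_one_of_pos hy0).trans (by linarith)
  have h5 : Real.log (1 / c) ≤ 1 / c := (Real.log_le_sub_one_of_pos (by positivity)).trans
    (by linarith)
  have h6 : 0 ≤ Real.log (1 / δ) := Real.log_nonneg (by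
    rw [le_div_iff₀ hδ0]
    linarith [hδ.2])
  have h7 : 0 ≤ (n : ℝ) := n.cast_nonneg
  have h8 : 0 < 1 / ε := by positivity
  have h9 : 0 < 1 / c := by positivity
  have h10 : 1 / (c * ε) = 1 / c * (1 / ε) := by rw [one_div_mul_one_div]
  have h11 : 2 / c = 2 * (1 / c) := by ring
  rw [h3, h10, h11]
  nlinarith [mul_nonneg h9.le h7, mul_nonneg h9.le h6, mul_pos h9 h8]

/-- The program that runs `A` on the projections to the directions in `ks` and combines the results
by `q`. -/
def reduceProg (A : Prog inTy outTy) (P : Fin 25 → Prog inTy inTy) (q : Prog postTy outTy)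
    (ks : List (Fin 25)) : Prog inTy outTy :=
  .comp (.pair (.id inTy) (callAll A P ks)) q

theorem reduceProg_runs {A : Prog inTy outTy} {P : Fin 25 → Prog inTy inTy}
    {q : Prog postTy outTy} {ks : List (Fin 25)} {ω : Tape} {x : inTy.Val} {ys : List outTy.Val}
    {y : outTy.Val} {t u : ℕ} (hys : (callAll A P ks).Runs ((ω.sub 0).sub 1) x ys t)
    (hy : q.Runs (ω.sub 1) (x, ys) y u) :
    (reduceProg A P q ks).Runs ω x y (1 + t + 1 + u + 1) :=
  ⟨(x, ys), 1 + t + 1, u, ⟨1, t, ⟨rfl, rfl⟩, hys, rfl⟩, hy, rfl⟩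

theorem polyTime_reduceProg {A : Prog inTy outTy} (hA : PolyTime 1 A) {c : ℚ} (hc0 : 0 < (c : ℝ))
    (hc : (c : ℝ) ≤ 1 / 50) {P : Fin 25 → Prog inTy inTy} {T : ℕ}
    (hP : ∀ k ω (x : inTy.Val), ∃ t ≤ T * (List.length x.2 + 1),
      (P k).Runs ω x (projInput c k x) t)
    {q : Prog postTy outTy} {T' : ℕ} (hq : ∀ ω x, ∃ y, ∃ t ≤ T', q.Runs ω x y t)
    (ks : List (Fin 25)) : PolyTime 4 (reduceProg A P q ks) := by
  obtain ⟨k₀, hk₀⟩ := hA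
  obtain ⟨D, hD⟩ := exists_nat_ge (3 + 2 / (c : ℝ))
  set N := ks.length with hN
  set Q : ℕ := N * (T + k₀ * D ^ k₀ + 4) + T' + 4 with hQ
  refine ⟨Q + k₀ + 1, fun ε hε δ hδ n x ω => ?_⟩
  obtain ⟨hε', hδ', -⟩ := projected_params_mem hc0 hc hε hδ
  have hlogδ : 0 ≤ Real.log (1 / δ) := Real.log_nonneg (by
    rw [le_div_iff₀ hδ.1]
    linarith [hδ.2])
  have hεinv : 0 < 1 / ε := one_div_pos.2 hε.1
  set M : ℝ := n + 1 / ε + Real.log (1 / δ) + 1 with hM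
  have hnM : (n : ℝ) + 1 ≤ M := by rw [hM]; linarith
  have hM1 : 1 ≤ M := by linarith [n.cast_nonneg (α := ℝ)]
  have hM0 : 0 ≤ M := zero_le_one.trans hM1
  obtain ⟨X, hX⟩ : ∃ X : ℝ, X = T * (n + 1) + k₀ * (D * M) ^ k₀ + 1 := ⟨_, rfl⟩
  have hX0 : 0 ≤ X := by rw [hX]; positivity
  -- running time of a single call
  have hcall : ∀ k ω, ∃ y, ∃ t ≤ ⌊X⌋₊, (Prog.comp (P k) A).Runs ω (encodeInput ε δ x) y t := by
    intro k ω
    obtain ⟨s, hs, hs'⟩ := hP k (ω.sub 0) (encodeInput ε δ x)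
    rw [projInput_encodeInput] at hs'
    obtain ⟨y, u, hu, hu'⟩ := hk₀ _ hε' _ hδ' n (fun j => projVec k (x j)) (ω.sub 1)
    refine ⟨y, s + u + 1, Nat.le_floor ?_, _, s, u, hs', hu, rfl⟩
    have hlen : List.length (encodeInput ε δ x).2 = n := List.length_ofFn
    rw [hlen] at hs
    have h1 : (s : ℝ) ≤ T * (n + 1) := by exact_mod_cast hs
    have h2 : (u : ℝ) ≤ k₀ * (D * M) ^ k₀ := by
      refine hu'.trans (mul_le_mul_of_nonneg_left (pow_le_pow_left₀ ?_ ?_ _) k₀.cast_nonneg)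
      · have h3 : 0 ≤ Real.log (1 / ((c : ℝ) * δ / Real.log (1 / (ε * δ)))) :=
          Real.log_nonneg (by
            rw [le_div_iff₀ hδ'.1]
            linarith [hδ'.2])
        have h4 : 0 < 1 / ((c : ℝ) * ε) := one_div_pos.2 hε'.1
        positivity
      · exact (projected_size_le hc0 hε hδ n).trans (mul_le_mul_of_nonneg_right hD hM0)
    push_cast
    linarith
  obtain ⟨ys, t, ht, hys⟩ := callAll_halts hcall ks ((ω.sub 0).sub 1)
  obtain ⟨y, u, hu, hu'⟩ := hq (ω.sub 1) (encodeInput ε δ x, ys)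
  refine ⟨y, _, reduceProg_runs hys hu', ?_⟩
  have hMk : M ≤ M ^ (k₀ + 1) := le_self_pow₀ hM1 (by omega)
  have hMk' : M ^ k₀ ≤ M ^ (k₀ + 1) := pow_le_pow_right₀ hM1 (by omega)
  have hMk1 : 1 ≤ M ^ (k₀ + 1) := hM1.trans hMk
  have hXle : X + 3 ≤ (T + k₀ * D ^ k₀ + 4) * M ^ (k₀ + 1) := by
    have h1 : (T : ℝ) * (n + 1) ≤ T * M ^ (k₀ + 1) :=
      mul_le_mul_of_nonneg_left (hnM.trans hMk) T.cast_nonneg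
    have h2 : (k₀ : ℝ) * (D * M) ^ k₀ ≤ k₀ * D ^ k₀ * M ^ (k₀ + 1) := by
      rw [mul_pow, ← mul_assoc]
      exact mul_le_mul_of_nonneg_left hMk' (by positivity)
    rw [hX]
    linarith
  have ht' : (t : ℝ) ≤ N * (X + 3) + 1 := by
    have h1 : (t : ℝ) ≤ (⌊X⌋₊ + 3) * N + 1 := by exact_mod_cast ht
    have h2 := mul_le_mul_of_nonneg_right (Nat.floor_le hX0) (N.cast_nonneg (α := ℝ))
    linarith
  have hu'' : (u : ℝ) ≤ T' := by exact_mod_cast hu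
  have hsum : ((1 + t + 1 + u + 1 : ℕ) : ℝ) ≤ Q * M ^ (k₀ + 1) := by
    have h1 : (T' + 4 : ℝ) ≤ (T' + 4) * M ^ (k₀ + 1) :=
      le_mul_of_one_le_right (by positivity) hMk1
    have h2 := mul_le_mul_of_nonneg_left hXle (N.cast_nonneg (α := ℝ))
    rw [hQ]
    push_cast
    linarith
  refine hsum.trans ?_
  have h1 : M ^ (k₀ + 1) ≤ M ^ (Q + k₀ + 1) := pow_le_pow_right₀ hM1 (by omega)
  have h2 : (Q : ℝ) ≤ (Q + k₀ + 1 : ℕ) := by exact_mod_cast (by omega)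
  exact mul_le_mul h2 h1 (by positivity) (by positivity)

/-- The reduction needs no samples in addition to those of the one-dimensional learner. -/
theorem exists_reduction (p₀ : ℝ) (hp₀ : 0 < p₀) : ∃ c : ℝ, 0 < c ∧ ∀ (f : ℝ → ℝ → ℕ)
    (A : Prog inTy outTy), PolyTime 1 A → Learns 1 p₀ A f →
      ∃ B : Prog inTy outTy, PolyTime 4 B ∧
        Learns 4 p₀ B fun ε δ => f (c * ε) (c * δ / Real.log (1 / (ε * δ))) := by
  obtain ⟨c₀, hc₀, post, ⟨q, T', hq⟩, hrec⟩ := exists_constTime_reconstruct p₀ hp₀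
  obtain ⟨c, hc0, hc⟩ := exists_rat_btwn (show (0 : ℝ) < min c₀ (1 / 50) by positivity)
  have hcc₀ : (c : ℝ) ≤ c₀ := hc.le.trans (min_le_left _ _)
  have hc50 : (c : ℝ) ≤ 1 / 50 := hc.le.trans (min_le_right _ _)
  refine ⟨c, hc0, fun f A hpoly hlearn => ?_⟩
  choose P T hP using exists_prog_projInput c
  obtain ⟨T₀, hT₀⟩ := (Set.finite_range T).bddAbove
  -- the first part is the time bound, the second one the probability of success
  refine ⟨reduceProg A P q (List.finRange 25), ?_, fun ε hε δ hδ F hF => ?_⟩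
  · refine polyTime_reduceProg hpoly hc0 hc50 (T := T₀) (fun k ω x => ?_)
      (fun ω x => ⟨_, hq ω x⟩) _
    obtain ⟨t, ht, ht'⟩ := hP k ω x
    exact ⟨t, ht.trans (Nat.mul_le_mul_right _ (hT₀ ⟨k, rfl⟩)), ht'⟩
  · obtain ⟨hε', hδ', hδ25⟩ := projected_params_mem hc0 hc50 hε hδ
    have hP' : ∀ k ω x, ∃ t, (P k).Runs ω x (projInput c k x) t := fun k ω x =>
      (hP k ω x).imp fun _ h => h.2
    have hbad := callAll_measure_le hlearn hP' hε' hδ' hF (List.nodup_finRange 25)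
    have hsub := fun j => measurePreserving_runLaw_sub F
      (f (c * ε) (c * δ / Real.log (1 / (ε * δ)))) j
    refine le_trans (le_trans (measure_mono fun z hz => ?_)
      ((measure_preimage_le_of_measurePreserving ((hsub 1).comp (hsub 0)) _).trans hbad)) ?_
    · by_contra hcon
      simp only [Set.mem_preimage, Set.mem_ofPred_eq, not_not,
        Function.comp_apply, Prod.map_fst, Prod.map_snd, id] at hcon
      obtain ⟨G, t, hrun, hG⟩ := hcon
      obtain ⟨H, hH, hclose⟩ := hrec c hc0 hcc₀ ε hε.1 hε.2.le δ (encodeInput ε δ z.1).2 F hF G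
        fun k => hG k (List.mem_finRange k)
      rw [← List.ofFn_eq_map] at hrun
      obtain ⟨u, -, hu⟩ := hq (z.2.sub 1)
        (encodeInput ε δ z.1, (List.ofFn fun k => encodeMixture (G k) : List outTy.Val))
      refine hz ⟨H, _, reduceProg_runs hrun (u := u) ?_, hclose⟩
      rw [← hH]
      exact hu
    · rw [List.length_finRange]
      refine le_trans (le_of_eq ?_) (ENNReal.ofReal_le_ofReal hδ25)
      rw [ENNReal.ofReal_mul (by norm_num)]
      norm_num

end GaussMix

theorem mainTheorem12 (p₀ : ℝ) (hp₀ : 0 < p₀) (hp₀' : p₀ ≤ 1 / 2) :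
    ∃ c C : ℝ, 0 < c ∧ 0 ≤ C ∧
      ∀ f : ℝ → ℝ → ℕ,
        (∃ A : GaussMix.Prog GaussMix.inTy GaussMix.outTy,
          GaussMix.PolyTime 1 A ∧ GaussMix.Learns 1 p₀ A f) →
        ∃ B : GaussMix.Prog GaussMix.inTy GaussMix.outTy,
          GaussMix.PolyTime 4 B ∧
          GaussMix.Learns 4 p₀ B fun ε δ =>
            f (c * ε) (c * δ / Real.log (1 / (ε * δ))) + ⌈C * Real.log (1 / δ)⌉₊ := by
  obtain ⟨c, hc, h⟩ := GaussMix.exists_reduction p₀ hp₀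
  refine ⟨c, 0, hc, le_rfl, fun f ⟨A, hpoly, hlearn⟩ => ?_⟩
  simpa only [zero_mul, Nat.ceil_zero, add_zero] using h f A hpoly hlearn
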